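/- Rings are associative but need not have a unit. For two-sided ideals $I,J$ of a ring, $I\cdot J$ is the additive group generated by the products $ab$ ($a\in I$, $b\in J$). The multiplier ring $\mathcal M(R)$ of a ring $R$ consists of the pairs $w$ of an endomorphism $a\mapsto aw$ of the left $R$-module $R$ and an endomorphism $a\mapsto wa$ of the right $R$-module $R$ with $(aw)b=a(wb)$ for all $a,b\in R$. A \emph{twisted partial action} of a group $G$ on a ring $A$ is a triple $\alpha=(\{D_g\}_{g\in G},\{\alpha_g\}_{g\in G},\{w_{g,h}\}_{(g,h)\in G\times G})$, where $D_g$ is a two-sided ideal of $A$, $\alpha_g:D_{g^{-1}}\to D_g$ is a ring isomorphism and $w_{g,h}$ is an invertible element of $\mathcal M(D_g\cdot D_{gh})$, such that for all $g,h,t\in G$: (i) $D_g^2=D_g$ and $D_g\cdot D_h=D_h\cdot D_g$; (ii) $D_1=A$ and $\alpha_1=\mathrm{id}_A$; (iii) $\alpha_g(D_{g^{-1}}\cdot D_h)=D_g\cdot D_{gh}$; (iv) $\alpha_g(\alpha_h(a))=w_{g,h}\,\alpha_{gh}(a)\,w_{g,h}^{-1}$ for all $a\in D_{h^{-1}}\cdot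 D_{h^{-1}g^{-1}}$; (v) $w_{1,g}=w_{g,1}=1$; (vi) $\alpha_g(a\,w_{h,t})\,w_{g,ht}=\alpha_g(a)\,w_{g,h}\,w_{gh,t}$ for all $a\in D_{g^{-1}}\cdot D_h\cdot D_{ht}$. It is \emph{global} if $D_g=A$ for all $g$. The \emph{crossed product} $A\rtimes_\alpha G$ is the ring $\bigoplus_{g\in G}D_g\delta_g$ with the multiplication $(a\delta_g)(b\delta_h)=\alpha_g(\alpha_g^{-1}(a)b)\,w_{g,h}\,\delta_{gh}$. A twisted global action $\beta=(B,\{\beta_g\},\{u_{g,h}\})$ of $G$ on a ring $B$ is a \emph{globalization} of $\alpha$ if there is an injective ring homomorphism $\varphi:A\to B$ such that $\varphi(A)$ is a two-sided ideal of $B$; $B=\sum_{g\in G}\beta_g(\varphi(A))$; and, for all $g,h\in G$, $\varphi(D_g)=\varphi(A)\cap\beta_g(\varphi(A))$, $\varphi\circ\alpha_g=\beta_g\circ\varphi$ on $D_{g^{-1}}$, and $\varphi(a\,w_{g,h})=\varphi(a)\,u_{g,h}$, $\varphi(w_{g,h}\,a)=u_{g,h}\,\varphi(a)$ for $a\in D_g\cdot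 D_{gh}$. A ring $R$ is \emph{left $s$-unital} if for every $a\in R$ there is $e\in R$ with $ea=a$, and \emph{idempotent} if $R^2=R$. Two idempotent rings $R$ and $S$ are \emph{Morita equivalent} if the categories of unitary torsion-free left modules over them (the modules $X$ over $R$ with $RX=X$ in which $Rx=0$ implies $x=0$, and likewise over $S$) are equivalent. A \emph{surjective Morita context} between $R$ and $S$ consists of a unitary $R$-$S$-bimodule $M$, a unitary $S$-$R$-bimodule $N$ (that is, $RM=M=MS$ and $SN=N=NR$), and surjective bimodule homomorphisms $\tau:M\otimes_S N\to R$ and $\tau':N\otimes_R M\to S$ such that $\tau(m\otimes n)m'=m\,\tau'(n\otimes m')$ and $\tau'(n\otimes m)n'=n\,\tau(m\otimes n')$ for all $m,m'\in M$ and $n,n'\in N$. \textbf{Theorem.} Let $\alpha$ be a twisted partial action of a group $G$ on a left $s$-unital ring $A$, and let $\beta$, acting on a ring $B$, be a globalization of $\alpha$. Then $A\rtimes_\alpha G$ and $B\rtimes_\beta G$ are idempotent rings, they are Morita equivalent, and there is a surjective Morita context between them. -/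

import Mathlib

universe u v w x y

/-! ### Products of two-sided ideals of a ring that need not have a unit -/

namespace TwoSidedIdeal

variable {A : Type u} [NonUnitalRing A]

/-- The product `I * J` of two-sided ideals: all finite sums of products `a * b` with
`a ∈ I` and `b ∈ J`. -/
instance instMulProd : Mul (TwoSidedIdeal A) where
  mul I J := TwoSidedIdeal.mk'
    (AddSubgroup.closure {z : A | ∃ a ∈ I, ∃ b ∈ J, z = a * b} : Set A)
    (AddSubgroup.zero_mem _) (fun hx hy => AddSubgroup.add_mem _ hx hy)
    (fun hx => AddSubgroup.neg_mem _ hx)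
    (by
      intro r z hz
      refine AddSubgroup.closure_induction (p := fun z _ => r * z ∈ AddSubgroup.closure
        {z : A | ∃ a ∈ I, ∃ b ∈ J, z = a * b}) ?_ ?_ ?_ ?_ hz
      · rintro _ ⟨a, ha, b, hb, rfl⟩
        exact AddSubgroup.subset_closure
          ⟨r * a, I.mul_mem_left _ _ ha, b, hb, (mul_assoc _ _ _).symm⟩
      · simp
      · intro p q _ _ hp hq
        rw [mul_add]; exact AddMemClass.add_mem hp hq
      · intro p _ hp
        rw [mul_neg]; exact NegMemClass.neg_mem hp)
    (by
      intro z r hz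
      refine AddSubgroup.closure_induction (p := fun z _ => z * r ∈ AddSubgroup.closure
        {z : A | ∃ a ∈ I, ∃ b ∈ J, z = a * b}) ?_ ?_ ?_ ?_ hz
      · rintro _ ⟨a, ha, b, hb, rfl⟩
        exact AddSubgroup.subset_closure
          ⟨a, ha, b * r, J.mul_mem_right _ _ hb, mul_assoc _ _ _⟩
      · simp
      · intro p q _ _ hp hq
        rw [add_mul]; exact AddMemClass.add_mem hp hq
      · intro p _ hp
        rw [neg_mul]; exact NegMemClass.neg_mem hp)

theorem mem_prod_iff {I J : TwoSidedIdeal A} {z : A} :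
    z ∈ I * J ↔ z ∈ AddSubgroup.closure {z : A | ∃ a ∈ I, ∃ b ∈ J, z = a * b} :=
  TwoSidedIdeal.mem_mk' (AddSubgroup.closure {z : A | ∃ a ∈ I, ∃ b ∈ J, z = a * b} : Set A)
    _ _ _ _ _ z

theorem prod_mem_prod {I J : TwoSidedIdeal A} {a b : A} (ha : a ∈ I) (hb : b ∈ J) :
    a * b ∈ I * J :=
  mem_prod_iff.2 (AddSubgroup.subset_closure ⟨a, ha, b, hb, rfl⟩)

theorem prod_induction {I J : TwoSidedIdeal A} {p : A → Prop}
    (hmul : ∀ a ∈ I, ∀ b ∈ J, p (a * b)) (h0 : p 0)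
    (hadd : ∀ a ∈ I * J, ∀ b ∈ I * J, p a → p b → p (a + b))
    (hneg : ∀ a ∈ I * J, p a → p (-a)) {z : A} (hz : z ∈ I * J) : p z := by
  refine AddSubgroup.closure_induction (p := fun z _ => p z) ?_ h0 ?_ ?_ (mem_prod_iff.1 hz)
  · rintro _ ⟨a, ha, b, hb, rfl⟩
    exact hmul a ha b hb
  · intro a b ha hb
    exact hadd a (mem_prod_iff.2 ha) b (mem_prod_iff.2 hb)
  · intro a ha
    exact hneg a (mem_prod_iff.2 ha)

theorem prod_le_of {I J K : TwoSidedIdeal A} (h : ∀ a ∈ I, ∀ b ∈ J, a * b ∈ K) : I * J ≤ K :=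
  fun _ hz => prod_induction (p := fun z => z ∈ K) h K.zero_mem
    (fun _ _ _ _ => K.add_mem) (fun _ _ => K.neg_mem) hz

theorem prod_le_left (I J : TwoSidedIdeal A) : I * J ≤ I :=
  prod_le_of fun _ ha _ _ => I.mul_mem_right _ _ ha

theorem prod_le_right (I J : TwoSidedIdeal A) : I * J ≤ J :=
  prod_le_of fun _ _ _ hb => J.mul_mem_left _ _ hb

theorem prod_mono {I I' J J' : TwoSidedIdeal A} (h : I ≤ I') (h' : J ≤ J') : I * J ≤ I' * J' :=
  prod_le_of fun _ ha _ hb => prod_mem_prod (h ha) (h' hb)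

theorem prod_assoc (I J K : TwoSidedIdeal A) : I * J * K = I * (J * K) := by
  apply le_antisymm
  · refine prod_le_of fun a ha b hb => ?_
    refine prod_induction (p := fun a => a * b ∈ I * (J * K)) ?_ ?_ ?_ ?_ ha
    · intro c hc d hd
      rw [mul_assoc]
      exact prod_mem_prod hc (prod_mem_prod hd hb)
    · simp
    · intro c _ d _ hc hd
      rw [add_mul]; exact AddMemClass.add_mem hc hd
    · intro c _ hc
      rw [neg_mul]; exact NegMemClass.neg_mem hc
  · refine prod_le_of fun a ha b hb => ?_
    refine prod_induction (p := fun b => a * b ∈ I * J * K) ?_ ?_ ?_ ?_ hb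
    · intro c hc d hd
      rw [← mul_assoc]
      exact prod_mem_prod (prod_mem_prod ha hc) hd
    · simp
    · intro c _ d _ hc hd
      rw [mul_add]; exact AddMemClass.add_mem hc hd
    · intro c _ hc
      rw [mul_neg]; exact NegMemClass.neg_mem hc

end TwoSidedIdeal

/-! ### The multiplier ring -/

/-- The ring of multipliers of a ring `R`: pairs consisting of an endomorphism of the left module
`R`, acting on the right of its argument (hence the opposite ring), and an endomorphism of the
right module `R`, such that `(a w) b = a (w b)`. -/
def multiplierRing (R : Type u) [NonUnitalRing R] :
    Subring ((AddMonoid.End R)ᵐᵒᵖ × AddMonoid.End R) where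
  carrier := {w | (∀ a b : R, w.1.unop (a * b) = a * w.1.unop b) ∧
    (∀ a b : R, w.2 (a * b) = w.2 a * b) ∧ (∀ a b : R, w.1.unop a * b = a * w.2 b)}
  mul_mem' := by
    rintro w w' ⟨h1, h2, h3⟩ ⟨h1', h2', h3'⟩
    refine ⟨fun a b => ?_, fun a b => ?_, fun a b => ?_⟩
    · simp [h1, h1']
    · simp [h2, h2']
    · simp [h3, h3']
  one_mem' := by
    refine ⟨fun a b => ?_, fun a b => ?_, fun a b => ?_⟩ <;> simp
  add_mem' := by
    rintro w w' ⟨h1, h2, h3⟩ ⟨h1', h2', h3'⟩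
    refine ⟨fun a b => ?_, fun a b => ?_, fun a b => ?_⟩
    · change w.1.unop (a * b) + w'.1.unop (a * b) = a * (w.1.unop b + w'.1.unop b)
      rw [h1, h1', mul_add]
    · change w.2 (a * b) + w'.2 (a * b) = (w.2 a + w'.2 a) * b
      rw [h2, h2', add_mul]
    · change (w.1.unop a + w'.1.unop a) * b = a * (w.2 b + w'.2 b)
      rw [add_mul, mul_add, h3, h3']
  zero_mem' := by
    refine ⟨fun a b => ?_, fun a b => ?_, fun a b => ?_⟩ <;> simp
  neg_mem' := by
    rintro w ⟨h1, h2, h3⟩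
    refine ⟨fun a b => ?_, fun a b => ?_, fun a b => ?_⟩
    · change -(w.1.unop (a * b)) = a * -(w.1.unop b)
      rw [h1, mul_neg]
    · change -(w.2 (a * b)) = -(w.2 a) * b
      rw [h2, neg_mul]
    · change -(w.1.unop a) * b = a * -(w.2 b)
      rw [neg_mul, mul_neg, h3]

namespace Multiplier

variable {A : Type u} [NonUnitalRing A] {I : TwoSidedIdeal A}

/-- `w a` for an invertible multiplier `w` of the ideal `I` of `A` and `a ∈ I`. -/
def lact (w : (multiplierRing I)ˣ) (a : A) (ha : a ∈ I) : A :=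
  (w : multiplierRing I).1.2 ⟨a, ha⟩

/-- `a w` for an invertible multiplier `w` of the ideal `I` of `A` and `a ∈ I`. -/
def ract (w : (multiplierRing I)ˣ) (a : A) (ha : a ∈ I) : A :=
  (w : multiplierRing I).1.1.unop ⟨a, ha⟩

theorem lact_mem (w : (multiplierRing I)ˣ) (a : A) (ha : a ∈ I) : lact w a ha ∈ I :=
  Subtype.prop _

theorem ract_mem (w : (multiplierRing I)ˣ) (a : A) (ha : a ∈ I) : ract w a ha ∈ I :=
  Subtype.prop _

theorem ract_add (w : (multiplierRing I)ˣ) (a b : A) (ha : a ∈ I) (hb : b ∈ I)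
    (hab : a + b ∈ I) : ract w (a + b) hab = ract w a ha + ract w b hb := by
  have := congrArg Subtype.val
    ((w : multiplierRing I).1.1.unop.map_add ⟨a, ha⟩ ⟨b, hb⟩)
  exact this

theorem ract_zero (w : (multiplierRing I)ˣ) (h : (0 : A) ∈ I) : ract w 0 h = 0 :=
  congrArg Subtype.val ((w : multiplierRing I).1.1.unop.map_zero)

theorem ract_neg (w : (multiplierRing I)ˣ) (a : A) (ha : a ∈ I) (hn : -a ∈ I) :
    ract w (-a) hn = -ract w a ha :=
  congrArg Subtype.val ((w : multiplierRing I).1.1.unop.map_neg ⟨a, ha⟩)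

theorem ract_mul (w : (multiplierRing I)ˣ) (a b : A) (ha : a ∈ I) (hb : b ∈ I)
    (hab : a * b ∈ I) : ract w (a * b) hab = a * ract w b hb :=
  congrArg Subtype.val ((w : multiplierRing I).2.1 ⟨a, ha⟩ ⟨b, hb⟩)

theorem lact_mul (w : (multiplierRing I)ˣ) (a b : A) (ha : a ∈ I) (hb : b ∈ I)
    (hab : a * b ∈ I) : lact w (a * b) hab = lact w a ha * b :=
  congrArg Subtype.val ((w : multiplierRing I).2.2.1 ⟨a, ha⟩ ⟨b, hb⟩)

theorem lact_add (w : (multiplierRing I)ˣ) (a b : A) (ha : a ∈ I) (hb : b ∈ I)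
    (hab : a + b ∈ I) : lact w (a + b) hab = lact w a ha + lact w b hb :=
  congrArg Subtype.val ((w : multiplierRing I).1.2.map_add ⟨a, ha⟩ ⟨b, hb⟩)

theorem lact_zero (w : (multiplierRing I)ˣ) (h : (0 : A) ∈ I) : lact w 0 h = 0 :=
  congrArg Subtype.val ((w : multiplierRing I).1.2.map_zero)

theorem lact_neg (w : (multiplierRing I)ˣ) (a : A) (ha : a ∈ I) (hn : -a ∈ I) :
    lact w (-a) hn = -lact w a ha :=
  congrArg Subtype.val ((w : multiplierRing I).1.2.map_neg ⟨a, ha⟩)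

theorem ract_inv_ract (w : (multiplierRing I)ˣ) (a : A) (ha : a ∈ I) :
    ract w (ract w⁻¹ a ha) (ract_mem _ _ _) = a := by
  have h : (w⁻¹ * w : (multiplierRing I)ˣ) = 1 := inv_mul_cancel w
  have h' := congrArg (fun z : (multiplierRing I)ˣ => ract z a ha) h
  exact h'

theorem ract_congr (w : (multiplierRing I)ˣ) {a b : A} (h : a = b) (ha : a ∈ I) (hb : b ∈ I) :
    ract w a ha = ract w b hb := by
  subst h; rfl

theorem lact_congr (w : (multiplierRing I)ˣ) {a b : A} (h : a = b) (ha : a ∈ I) (hb : b ∈ I) :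
    lact w a ha = lact w b hb := by
  subst h; rfl

/-- `r (x w) = (r x) w` for `x` in an idempotent ideal `I` of `A` and any `r` in `A`. -/
theorem mul_ract (w : (multiplierRing I)ˣ) (hI : I ≤ I * I) (r x : A) (hx : x ∈ I)
    (hrx : r * x ∈ I) : r * ract w x hx = ract w (r * x) hrx := by
  have key : ∀ (hx : x ∈ I) (hrx : r * x ∈ I), r * ract w x hx = ract w (r * x) hrx := by
    refine TwoSidedIdeal.prod_induction (p := fun x => ∀ (hx : x ∈ I) (hrx : r * x ∈ I),
      r * ract w x hx = ract w (r * x) hrx) ?_ ?_ ?_ ?_ (hI hx)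
    · intro p hp q hq h1 h2
      have h3 := I.mul_mem_left r p hp
      rw [ract_mul w p q hp hq, ← mul_assoc, ← ract_mul w (r * p) q h3 hq (by rwa [mul_assoc])]
      exact ract_congr w (mul_assoc _ _ _) _ _
    · intro h1 h2
      rw [ract_zero]
      refine (mul_zero r).trans ?_
      exact ((ract_congr w (mul_zero r) h2 h1).trans (ract_zero w h1)).symm
    · intro p hp q hq hp' hq' h1 h2
      have hp1 := TwoSidedIdeal.prod_le_left _ _ hp
      have hq1 := TwoSidedIdeal.prod_le_left _ _ hq
      have hp2 := I.mul_mem_left r p hp1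
      have hq2 := I.mul_mem_left r q hq1
      rw [ract_add w p q hp1 hq1, mul_add, hp' hp1 hp2, hq' hq1 hq2,
        ← ract_add w _ _ hp2 hq2 (I.add_mem hp2 hq2)]
      exact ract_congr w (mul_add _ _ _).symm _ _
    · intro p hp hp' h1 h2
      have hp1 := TwoSidedIdeal.prod_le_left _ _ hp
      have hp2 := I.mul_mem_left r p hp1
      rw [ract_neg w p hp1, mul_neg, hp' hp1 hp2, ← ract_neg w _ hp2 (I.neg_mem hp2)]
      exact ract_congr w (mul_neg _ _).symm _ _
  exact key hx hrx

/-- Multipliers of `I` preserve idempotent ideals contained in `I`. -/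
theorem ract_mem_of_idem (w : (multiplierRing I)ˣ) {Q : TwoSidedIdeal A} (hQ : Q ≤ Q * Q)
    (hI : Q ≤ I) {a : A} (ha : a ∈ Q) : ract w a (hI ha) ∈ Q := by
  have key : ∀ h : a ∈ I, ract w a h ∈ Q := by
    refine TwoSidedIdeal.prod_induction (p := fun a => ∀ h : a ∈ I, ract w a h ∈ Q)
      ?_ ?_ ?_ ?_ (hQ ha)
    · intro p hp q hq h
      rw [ract_mul w p q (hI hp) (hI hq)]
      exact Q.mul_mem_right _ _ hp
    · intro h
      rw [ract_zero]; exact Q.zero_mem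
    · intro p hp q hq hp' hq' h
      have hp1 := hI (TwoSidedIdeal.prod_le_left _ _ hp)
      have hq1 := hI (TwoSidedIdeal.prod_le_left _ _ hq)
      rw [ract_add w p q hp1 hq1]
      exact Q.add_mem (hp' _) (hq' _)
    · intro p hp hp' h
      rw [ract_neg w p (hI (TwoSidedIdeal.prod_le_left _ _ hp))]
      exact Q.neg_mem (hp' _)
  exact key _

end Multiplier

/-! ### Twisted partial actions -/

/-- The ideals `D g` and the isomorphisms `α g : D g⁻¹ → D g` of a twisted partial action, with the
axioms which do not involve the twisting multipliers. -/
structure PartialActionFrame (G : Type w) [Group G] (A : Type u) [NonUnitalRing A] where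
  /-- the ideals -/
  D : G → TwoSidedIdeal A
  /-- the isomorphisms -/
  α : ∀ g : G, D g⁻¹ ≃+* D g
  D_idem : ∀ g, D g * D g = D g
  D_comm : ∀ g h, D g * D h = D h * D g
  D_one : D 1 = ⊤
  α_one : ∀ a : D (1 : G)⁻¹, (α 1 a : A) = a
  /-- `α g` maps `D g⁻¹ * D h` onto `D g * D (g * h)` -/
  image_α : ∀ g h : G, {z : A | ∃ a : D g⁻¹, (a : A) ∈ D g⁻¹ * D h ∧ (α g a : A) = z} =
    {z : A | z ∈ D g * D (g * h)}

namespace PartialActionFrame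

variable {G : Type w} [Group G] {A : Type u} [NonUnitalRing A] (F : PartialActionFrame G A)

/-- `α g a`, as an element of `A`, for `a ∈ D g⁻¹`. -/
def ap (g : G) (a : A) (ha : a ∈ F.D g⁻¹) : A := F.α g ⟨a, ha⟩

/-- `(α g)⁻¹ a`, as an element of `A`, for `a ∈ D g`. -/
def apInv (g : G) (a : A) (ha : a ∈ F.D g) : A := (F.α g).symm ⟨a, ha⟩

theorem ap_mem (g : G) (a : A) (ha : a ∈ F.D g⁻¹) : F.ap g a ha ∈ F.D g := Subtype.prop _

theorem apInv_mem (g : G) (a : A) (ha : a ∈ F.D g) : F.apInv g a ha ∈ F.D g⁻¹ := Subtype.prop _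

theorem ap_mem_prod (g h : G) {a : A} (ha : a ∈ F.D g⁻¹) (hh : a ∈ F.D g⁻¹ * F.D h) :
    F.ap g a ha ∈ F.D g * F.D (g * h) := by
  have : F.ap g a ha ∈ {z : A | z ∈ F.D g * F.D (g * h)} := by
    rw [← F.image_α]
    exact ⟨⟨a, ha⟩, hh, rfl⟩
  exact this

theorem ap_congr (g : G) {a b : A} (h : a = b) (ha : a ∈ F.D g⁻¹) (hb : b ∈ F.D g⁻¹) :
    F.ap g a ha = F.ap g b hb := by
  subst h; rfl

theorem apInv_congr (g : G) {a b : A} (h : a = b) (ha : a ∈ F.D g) (hb : b ∈ F.D g) :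
    F.apInv g a ha = F.apInv g b hb := by
  subst h; rfl

theorem ap_add (g : G) (a b : A) (ha : a ∈ F.D g⁻¹) (hb : b ∈ F.D g⁻¹) (hab : a + b ∈ F.D g⁻¹) :
    F.ap g (a + b) hab = F.ap g a ha + F.ap g b hb :=
  congrArg Subtype.val ((F.α g).map_add ⟨a, ha⟩ ⟨b, hb⟩)

theorem ap_mul (g : G) (a b : A) (ha : a ∈ F.D g⁻¹) (hb : b ∈ F.D g⁻¹) (hab : a * b ∈ F.D g⁻¹) :
    F.ap g (a * b) hab = F.ap g a ha * F.ap g b hb :=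
  congrArg Subtype.val ((F.α g).map_mul ⟨a, ha⟩ ⟨b, hb⟩)

theorem ap_zero (g : G) (h : (0 : A) ∈ F.D g⁻¹) : F.ap g 0 h = 0 :=
  congrArg Subtype.val (F.α g).map_zero

theorem ap_neg (g : G) (a : A) (ha : a ∈ F.D g⁻¹) (hn : -a ∈ F.D g⁻¹) :
    F.ap g (-a) hn = -F.ap g a ha := by
  have h0 : -a + a ∈ F.D g⁻¹ := TwoSidedIdeal.add_mem _ hn ha
  have h := F.ap_add g (-a) a hn ha h0
  simp only [neg_add_cancel, F.ap_zero] at h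
  exact eq_neg_of_add_eq_zero_left h.symm

theorem apInv_add (g : G) (a b : A) (ha : a ∈ F.D g) (hb : b ∈ F.D g) (hab : a + b ∈ F.D g) :
    F.apInv g (a + b) hab = F.apInv g a ha + F.apInv g b hb :=
  congrArg Subtype.val ((F.α g).symm.map_add ⟨a, ha⟩ ⟨b, hb⟩)

theorem apInv_mul (g : G) (a b : A) (ha : a ∈ F.D g) (hb : b ∈ F.D g) (hab : a * b ∈ F.D g) :
    F.apInv g (a * b) hab = F.apInv g a ha * F.apInv g b hb :=
  congrArg Subtype.val ((F.α g).symm.map_mul ⟨a, ha⟩ ⟨b, hb⟩)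

theorem apInv_zero (g : G) (h : (0 : A) ∈ F.D g) : F.apInv g 0 h = 0 :=
  congrArg Subtype.val (F.α g).symm.map_zero

theorem apInv_neg (g : G) (a : A) (ha : a ∈ F.D g) (hn : -a ∈ F.D g) :
    F.apInv g (-a) hn = -F.apInv g a ha := by
  have h0 : -a + a ∈ F.D g := TwoSidedIdeal.add_mem _ hn ha
  have h := F.apInv_add g (-a) a hn ha h0
  simp only [neg_add_cancel, F.apInv_zero] at h
  exact eq_neg_of_add_eq_zero_left h.symm

theorem ap_apInv (g : G) (a : A) (ha : a ∈ F.D g) :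
    F.ap g (F.apInv g a ha) (F.apInv_mem _ _ _) = a :=
  congrArg Subtype.val ((F.α g).apply_symm_apply ⟨a, ha⟩)

theorem apInv_ap (g : G) (a : A) (ha : a ∈ F.D g⁻¹) :
    F.apInv g (F.ap g a ha) (F.ap_mem _ _ _) = a :=
  congrArg Subtype.val ((F.α g).symm_apply_apply ⟨a, ha⟩)

theorem apInv_mem_prod (g h : G) {a : A} (ha : a ∈ F.D g) (hh : a ∈ F.D g * F.D (g * h)) :
    F.apInv g a ha ∈ F.D g⁻¹ * F.D h := by
  have h1 : a ∈ {z : A | z ∈ F.D g * F.D (g * h)} := hh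
  rw [← F.image_α] at h1
  obtain ⟨b, hb, rfl⟩ := h1
  have := F.apInv_ap g b b.2
  have h2 : F.apInv g (F.α g b : A) ha = b := this
  rw [h2]; exact hb

/-- The product of three of the ideals is idempotent. -/
theorem triple_idem (g h t : G) :
    F.D g * F.D h * F.D t ≤ (F.D g * F.D h * F.D t) * (F.D g * F.D h * F.D t) := by
  apply le_of_eq
  have e : (F.D g * F.D h * F.D t) * (F.D g * F.D h * F.D t) =
      (F.D g * F.D g) * (F.D h * F.D h) * (F.D t * F.D t) := by
    simp only [TwoSidedIdeal.prod_assoc]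
    rw [← TwoSidedIdeal.prod_assoc (F.D t) (F.D g), F.D_comm t g,
      TwoSidedIdeal.prod_assoc (F.D g) (F.D t), ← TwoSidedIdeal.prod_assoc (F.D h) (F.D g),
      F.D_comm h g, TwoSidedIdeal.prod_assoc (F.D g) (F.D h),
      ← TwoSidedIdeal.prod_assoc (F.D t) (F.D h), F.D_comm t h,
      TwoSidedIdeal.prod_assoc (F.D h) (F.D t)]
  rw [e, F.D_idem, F.D_idem, F.D_idem]

theorem pair_idem (g h : G) :
    F.D g * F.D h ≤ (F.D g * F.D h) * (F.D g * F.D h) := by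
  apply le_of_eq
  have e : (F.D g * F.D h) * (F.D g * F.D h) = (F.D g * F.D g) * (F.D h * F.D h) := by
    simp only [TwoSidedIdeal.prod_assoc]
    rw [← TwoSidedIdeal.prod_assoc (F.D h) (F.D g), F.D_comm h g,
      TwoSidedIdeal.prod_assoc (F.D g) (F.D h)]
  rw [e, F.D_idem, F.D_idem]

theorem triple_le_fst (g h t : G) : F.D g * F.D h * F.D t ≤ F.D g :=
  (TwoSidedIdeal.prod_le_left _ _).trans (TwoSidedIdeal.prod_le_left _ _)

theorem triple_le_fst_snd (g h t : G) : F.D g * F.D h * F.D t ≤ F.D g * F.D h :=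
  TwoSidedIdeal.prod_le_left _ _

theorem triple_le_fst_thd (g h t : G) : F.D g * F.D h * F.D t ≤ F.D g * F.D t :=
  TwoSidedIdeal.prod_mono (TwoSidedIdeal.prod_le_left _ _) le_rfl

theorem triple_le_snd_thd (g h t : G) : F.D g * F.D h * F.D t ≤ F.D h * F.D t :=
  TwoSidedIdeal.prod_mono (TwoSidedIdeal.prod_le_right _ _) le_rfl

/-- `α g` maps `D g⁻¹ * D h * D t` into `D g * D (g * h) * D (g * t)`. -/
theorem ap_mem_triple (g h t : G) {a : A} (ha : a ∈ F.D g⁻¹)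
    (hh : a ∈ F.D g⁻¹ * F.D h * F.D t) :
    F.ap g a ha ∈ F.D g * F.D (g * h) * F.D (g * t) := by
  have key : ∀ ha : a ∈ F.D g⁻¹, F.ap g a ha ∈ F.D g * F.D (g * h) * F.D (g * t) := by
    refine TwoSidedIdeal.prod_induction (p := fun a => ∀ ha : a ∈ F.D g⁻¹,
      F.ap g a ha ∈ F.D g * F.D (g * h) * F.D (g * t)) ?_ ?_ ?_ ?_ (F.triple_idem g⁻¹ h t hh)
    · intro p hp q hq hpq
      have hp1 := F.triple_le_fst _ _ _ hp
      have hq1 := F.triple_le_fst _ _ _ hq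
      rw [F.ap_mul g p q hp1 hq1]
      exact TwoSidedIdeal.prod_mem_prod (F.ap_mem_prod g h hp1 (F.triple_le_fst_snd _ _ _ hp))
        (TwoSidedIdeal.prod_le_right _ _
          (F.ap_mem_prod g t hq1 (F.triple_le_fst_thd _ _ _ hq)))
    · intro h0
      rw [F.ap_zero]; exact TwoSidedIdeal.zero_mem _
    · intro p hp q hq hp' hq' hpq
      have hp1 := F.triple_le_fst _ _ _ (TwoSidedIdeal.prod_le_left _ _ hp)
      have hq1 := F.triple_le_fst _ _ _ (TwoSidedIdeal.prod_le_left _ _ hq)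
      rw [F.ap_add g p q hp1 hq1]
      exact TwoSidedIdeal.add_mem _ (hp' hp1) (hq' hq1)
    · intro p hp hp' hn
      have hp1 := F.triple_le_fst _ _ _ (TwoSidedIdeal.prod_le_left _ _ hp)
      rw [F.ap_neg g p hp1]
      exact TwoSidedIdeal.neg_mem _ (hp' hp1)
  exact key ha

/-- `α h a ∈ D g⁻¹` for `a ∈ D h⁻¹ * D (g * h)⁻¹`. -/
theorem ap_mem_inv {g h : G} {a : A} (ha : a ∈ F.D h⁻¹ * F.D (g * h)⁻¹) :
    F.ap h a (TwoSidedIdeal.prod_le_left _ _ ha) ∈ F.D g⁻¹ := by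
  have h1 := F.ap_mem_prod h (g * h)⁻¹ (TwoSidedIdeal.prod_le_left _ _ ha) ha
  have h2 := TwoSidedIdeal.prod_le_right _ _ h1
  rwa [show h * (g * h)⁻¹ = g⁻¹ by group] at h2

/-- `α (g * h) a ∈ D g * D (g * h)` for `a ∈ D h⁻¹ * D (g * h)⁻¹`. -/
theorem ap_mul_mem {g h : G} {a : A} (ha : a ∈ F.D h⁻¹ * F.D (g * h)⁻¹) :
    F.ap (g * h) a (TwoSidedIdeal.prod_le_right _ _ ha) ∈ F.D g * F.D (g * h) := by
  have h0 : a ∈ F.D (g * h)⁻¹ * F.D h⁻¹ := by rwa [F.D_comm]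
  have h1 := F.ap_mem_prod (g * h) h⁻¹ (TwoSidedIdeal.prod_le_right _ _ ha) h0
  rwa [F.D_comm, show g * h * h⁻¹ = g by group] at h1

open Multiplier in
theorem ract_mem_triple {g h t : G} (w : (multiplierRing (F.D h * F.D t : TwoSidedIdeal A))ˣ)
    {a : A} (ha : a ∈ F.D g * F.D h * F.D t) :
    ract w a (F.triple_le_snd_thd _ _ _ ha) ∈ F.D g * F.D h * F.D t :=
  ract_mem_of_idem w (F.triple_idem g h t) (F.triple_le_snd_thd g h t) ha

open Multiplier in
theorem ract_mem_triple' {g h t : G} (w : (multiplierRing (F.D g * F.D h : TwoSidedIdeal A))ˣ)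
    {a : A} (ha : a ∈ F.D g * F.D h * F.D t) :
    ract w a (F.triple_le_fst_snd _ _ _ ha) ∈ F.D g * F.D h * F.D t :=
  ract_mem_of_idem w (F.triple_idem g h t) (F.triple_le_fst_snd g h t) ha

/-- `α g a ∈ D g * D (g * h) * D (g * h * t)` for `a ∈ D g⁻¹ * D h * D (h * t)`. -/
theorem ap_mem_triple' {g h t : G} {a : A} (ha : a ∈ F.D g⁻¹ * F.D h * F.D (h * t)) :
    F.ap g a (F.triple_le_fst _ _ _ ha) ∈ F.D g * F.D (g * h) * F.D (g * h * t) := by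
  have := F.ap_mem_triple g h (h * t) (F.triple_le_fst _ _ _ ha) ha
  rwa [← mul_assoc] at this

open Multiplier in
/-- `α g (a w)`, for `a ∈ D g⁻¹ * D h * D t` and a multiplier `w` of `D h * D t`. -/
def apRact {g h t : G} (w : (multiplierRing (F.D h * F.D t : TwoSidedIdeal A))ˣ)
    (a : A) (ha : a ∈ F.D g⁻¹ * F.D h * F.D t) : A :=
  F.ap g (ract w a (F.triple_le_snd_thd _ _ _ ha)) (F.triple_le_fst _ _ _ (F.ract_mem_triple w ha))

theorem apRact_mem {g h t : G} (w : (multiplierRing (F.D h * F.D t : TwoSidedIdeal A))ˣ)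
    {a : A} (ha : a ∈ F.D g⁻¹ * F.D h * F.D t) :
    F.apRact w a ha ∈ F.D g * F.D (g * t) :=
  F.ap_mem_prod g t _ (F.triple_le_fst_thd _ _ _ (F.ract_mem_triple w ha))

open Multiplier in
/-- `(α g a) w`, for `a ∈ D g⁻¹ * D h * D (h * t)` and a multiplier `w` of `D g * D (g * h)`. -/
def ractAp {g h t : G} (w : (multiplierRing (F.D g * F.D (g * h) : TwoSidedIdeal A))ˣ)
    (a : A) (ha : a ∈ F.D g⁻¹ * F.D h * F.D (h * t)) : A :=
  ract w (F.ap g a (F.triple_le_fst _ _ _ ha))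
    (F.triple_le_fst_snd _ _ _ (F.ap_mem_triple' ha))

theorem ractAp_mem {g h t : G} (w : (multiplierRing (F.D g * F.D (g * h) : TwoSidedIdeal A))ˣ)
    {a : A} (ha : a ∈ F.D g⁻¹ * F.D h * F.D (h * t)) :
    F.ractAp w a ha ∈ F.D (g * h) * F.D (g * h * t) :=
  F.triple_le_snd_thd _ _ _ (F.ract_mem_triple' w (F.ap_mem_triple' ha))

end PartialActionFrame

open Multiplier in
/-- A twisted partial action of the group `G` on the ring `A`. -/
structure TwistedPartialAction (G : Type w) [Group G] (A : Type u) [NonUnitalRing A] extends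
    PartialActionFrame G A where
  /-- the twisting: invertible multipliers of the ideals `D g * D (g * h)` -/
  w : ∀ g h : G, (multiplierRing (D g * D (g * h) : TwoSidedIdeal A))ˣ
  /-- `α g (α h a) = w g h (α (g h) a) (w g h)⁻¹` for all `a ∈ D h⁻¹ * D (h⁻¹ * g⁻¹)` -/
  comp_eq : ∀ (g h : G) (a : A) (ha : a ∈ D h⁻¹ * D (g * h)⁻¹),
    toPartialActionFrame.ap g
        (toPartialActionFrame.ap h a (TwoSidedIdeal.prod_le_left _ _ ha))
        (toPartialActionFrame.ap_mem_inv ha) =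
      ract (w g h)⁻¹ (lact (w g h)
        (toPartialActionFrame.ap (g * h) a (TwoSidedIdeal.prod_le_right _ _ ha))
        (toPartialActionFrame.ap_mul_mem ha)) (lact_mem _ _ _)
  w_one_left : ∀ g, w 1 g = 1
  w_one_right : ∀ g, w g 1 = 1
  /-- `α g (a w h t) w g (h t) = α g a w g h w (g h) t` for all `a ∈ D g⁻¹ * D h * D (h t)` -/
  cocycle : ∀ (g h t : G) (a : A) (ha : a ∈ D g⁻¹ * D h * D (h * t)),
    ract (w g (h * t)) (toPartialActionFrame.apRact (w h t) a ha)
        (toPartialActionFrame.apRact_mem (w h t) ha) =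
      ract (w (g * h) t) (toPartialActionFrame.ractAp (w g h) a ha)
        (toPartialActionFrame.ractAp_mem (w g h) ha)

namespace TwistedPartialAction

open Multiplier

variable {G : Type w} [Group G] {A : Type u} [NonUnitalRing A] (α : TwistedPartialAction G A)

/-- The twisted partial action is global if all its ideals are the whole ring. -/
def IsGlobal : Prop := ∀ g, α.D g = ⊤

theorem IsGlobal.mem {α : TwistedPartialAction G A} (h : α.IsGlobal) (g : G) (a : A) :
    a ∈ α.D g := by
  rw [h g]; trivial

theorem IsGlobal.mem_prod {α : TwistedPartialAction G A} (hα : α.IsGlobal) (g h : G) (a : A) :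
    a ∈ α.D g * α.D h := by
  rw [hα h, ← hα g, α.D_idem]; exact hα.mem g a

/-! ### The crossed product -/

theorem apInv_mul_mem {g h : G} {a b : A} (ha : a ∈ α.D g) (hb : b ∈ α.D h) :
    α.apInv g a ha * b ∈ α.D g⁻¹ * α.D h :=
  TwoSidedIdeal.prod_mem_prod (α.apInv_mem g a ha) hb

/-- `α g ((α g)⁻¹ a * b)` for `a ∈ D g`. -/
def core (g : G) (a b : A) (ha : a ∈ α.D g) : A :=
  α.ap g (α.apInv g a ha * b) (TwoSidedIdeal.mul_mem_right _ _ _ (α.apInv_mem g a ha))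

theorem core_mem {g h : G} {a b : A} (ha : a ∈ α.D g) (hb : b ∈ α.D h) :
    α.core g a b ha ∈ α.D g * α.D (g * h) :=
  α.ap_mem_prod g h _ (α.apInv_mul_mem ha hb)

/-- The coefficient `α g ((α g)⁻¹ a * b) w g h` of `δ (g * h)` in the product
`(a δ g) (b δ h)`. -/
def coeff (g h : G) (a b : A) (ha : a ∈ α.D g) (hb : b ∈ α.D h) : A :=
  ract (α.w g h) (α.core g a b ha) (α.core_mem ha hb)

theorem coeff_mem {g h : G} {a b : A} (ha : a ∈ α.D g) (hb : b ∈ α.D h) :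
    α.coeff g h a b ha hb ∈ α.D (g * h) :=
  TwoSidedIdeal.prod_le_right _ _ (ract_mem _ _ _)

theorem core_congr {g : G} {a a' b : A} (h : a = a') (ha : a ∈ α.D g) (ha' : a' ∈ α.D g) :
    α.core g a b ha = α.core g a' b ha' := by
  subst h; rfl

theorem core_add_left {g : G} {a a' b : A} (ha : a ∈ α.D g) (ha' : a' ∈ α.D g)
    (h : a + a' ∈ α.D g) : α.core g (a + a') b h = α.core g a b ha + α.core g a' b ha' := by
  unfold core
  rw [← α.ap_add _ _ _ _ _ (TwoSidedIdeal.add_mem _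
    (TwoSidedIdeal.mul_mem_right _ _ _ (α.apInv_mem g a ha))
    (TwoSidedIdeal.mul_mem_right _ _ _ (α.apInv_mem g a' ha')))]
  apply α.ap_congr
  rw [α.apInv_add g a a' ha ha', add_mul]

theorem core_add_right {g : G} {a b b' : A} (ha : a ∈ α.D g) :
    α.core g a (b + b') ha = α.core g a b ha + α.core g a b' ha := by
  unfold core
  rw [← α.ap_add _ _ _ _ _ (TwoSidedIdeal.add_mem _
    (TwoSidedIdeal.mul_mem_right _ _ _ (α.apInv_mem g a ha))
    (TwoSidedIdeal.mul_mem_right _ _ _ (α.apInv_mem g a ha)))]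
  exact α.ap_congr g (mul_add _ _ _) _ _

theorem core_zero_left {g : G} {b : A} (h : (0 : A) ∈ α.D g) : α.core g 0 b h = 0 := by
  refine Eq.trans ?_ (α.ap_zero g (TwoSidedIdeal.zero_mem _))
  apply α.ap_congr
  rw [α.apInv_zero, zero_mul]

theorem core_neg_left {g : G} {a b : A} (ha : a ∈ α.D g) (h : -a ∈ α.D g) :
    α.core g (-a) b h = -α.core g a b ha := by
  have h0 : -a + a ∈ α.D g := TwoSidedIdeal.add_mem _ h ha
  have h1 := α.core_add_left (b := b) h ha h0
  rw [α.core_congr (neg_add_cancel a) h0 (TwoSidedIdeal.zero_mem _), core_zero_left] at h1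
  exact eq_neg_of_add_eq_zero_left h1.symm

theorem core_mul_left_of_mem {g : G} {r a b : A} (hr : r ∈ α.D g) (ha : a ∈ α.D g)
    (h : r * a ∈ α.D g) : α.core g (r * a) b h = r * α.core g a b ha := by
  have h1 : α.core g (r * a) b h = α.ap g (α.apInv g r hr * (α.apInv g a ha * b))
      (TwoSidedIdeal.mul_mem_right _ _ _ (α.apInv_mem g r hr)) := by
    apply α.ap_congr
    rw [α.apInv_mul g r a hr ha, mul_assoc]
  rw [h1, α.ap_mul g _ _ (α.apInv_mem g r hr)
    (TwoSidedIdeal.mul_mem_right _ _ _ (α.apInv_mem g a ha)), α.ap_apInv]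
  rfl

theorem core_mul_left {g : G} {r a b : A} (ha : a ∈ α.D g) (h : r * a ∈ α.D g) :
    α.core g (r * a) b h = r * α.core g a b ha := by
  have key : ∀ (ha : a ∈ α.D g) (h : r * a ∈ α.D g),
      α.core g (r * a) b h = r * α.core g a b ha := by
    refine TwoSidedIdeal.prod_induction (p := fun a => ∀ (ha : a ∈ α.D g) (h : r * a ∈ α.D g),
      α.core g (r * a) b h = r * α.core g a b ha) ?_ ?_ ?_ ?_ ((α.D_idem g).ge ha)
    · intro p hp q hq h1 h2
      have h3 := (α.D g).mul_mem_left r p hp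
      have h4 : r * p * q ∈ α.D g := by rwa [mul_assoc]
      have e := α.core_mul_left_of_mem (b := b) h3 hq h4
      rw [α.core_mul_left_of_mem hp hq]
      refine Eq.trans ?_ (e.trans (mul_assoc _ _ _))
      exact α.core_congr (mul_assoc _ _ _).symm _ _
    · intro h1 h2
      rw [α.core_congr (mul_zero r) h2 h1, core_zero_left, mul_zero]
    · intro p hp q hq hp' hq' h1 h2
      have hp1 := TwoSidedIdeal.prod_le_left _ _ hp
      have hq1 := TwoSidedIdeal.prod_le_left _ _ hq
      have hp2 := (α.D g).mul_mem_left r p hp1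
      have hq2 := (α.D g).mul_mem_left r q hq1
      rw [α.core_congr (mul_add r p q) h2 (TwoSidedIdeal.add_mem _ hp2 hq2),
        α.core_add_left hp2 hq2, α.core_add_left hp1 hq1, hp' hp1 hp2, hq' hq1 hq2, mul_add]
    · intro p hp hp' h1 h2
      have hp1 := TwoSidedIdeal.prod_le_left _ _ hp
      have hp2 := (α.D g).mul_mem_left r p hp1
      rw [α.core_congr (mul_neg r p) h2 (TwoSidedIdeal.neg_mem _ hp2),
        α.core_neg_left hp2, α.core_neg_left hp1, hp' hp1 hp2, mul_neg]
  exact key ha h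

theorem core_ap {g : G} {a b : A} (ha : a ∈ α.D g⁻¹) :
    α.core g (α.ap g a ha) b (α.ap_mem g a ha) =
      α.ap g (a * b) (TwoSidedIdeal.mul_mem_right _ _ _ ha) := by
  apply α.ap_congr
  rw [α.apInv_ap]

theorem lact_core {g h : G} {z c : A} (hz : z ∈ α.D h⁻¹ * α.D (g * h)⁻¹)
    (hzc : z * c ∈ α.D h⁻¹ * α.D (g * h)⁻¹) :
    α.core (g * h) (lact (α.w g h)
        (α.ap (g * h) z (TwoSidedIdeal.prod_le_right _ _ hz)) (α.ap_mul_mem hz)) c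
        (TwoSidedIdeal.prod_le_right _ _ (lact_mem _ _ _)) =
      lact (α.w g h) (α.ap (g * h) (z * c) (TwoSidedIdeal.prod_le_right _ _ hzc))
        (α.ap_mul_mem hzc) := by
  have key : ∀ (hz : z ∈ α.D h⁻¹ * α.D (g * h)⁻¹) (hzc : z * c ∈ α.D h⁻¹ * α.D (g * h)⁻¹),
      α.core (g * h) (lact (α.w g h)
        (α.ap (g * h) z (TwoSidedIdeal.prod_le_right _ _ hz)) (α.ap_mul_mem hz)) c
        (TwoSidedIdeal.prod_le_right _ _ (lact_mem _ _ _)) =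
      lact (α.w g h) (α.ap (g * h) (z * c) (TwoSidedIdeal.prod_le_right _ _ hzc))
        (α.ap_mul_mem hzc) := by
    refine TwoSidedIdeal.prod_induction (p := fun z => ∀ (hz : z ∈ α.D h⁻¹ * α.D (g * h)⁻¹)
      (hzc : z * c ∈ α.D h⁻¹ * α.D (g * h)⁻¹),
      α.core (g * h) (lact (α.w g h)
        (α.ap (g * h) z (TwoSidedIdeal.prod_le_right _ _ hz)) (α.ap_mul_mem hz)) c
        (TwoSidedIdeal.prod_le_right _ _ (lact_mem _ _ _)) =
      lact (α.w g h) (α.ap (g * h) (z * c) (TwoSidedIdeal.prod_le_right _ _ hzc))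
        (α.ap_mul_mem hzc)) ?_ ?_ ?_ ?_ (α.pair_idem _ _ hz)
    · intro p hp q hq h1 h2
      have hp1 := TwoSidedIdeal.prod_le_right _ _ hp
      have hq1 := TwoSidedIdeal.prod_le_right _ _ hq
      have hqc : q * c ∈ α.D h⁻¹ * α.D (g * h)⁻¹ := TwoSidedIdeal.mul_mem_right _ _ _ hq
      have hqc1 := TwoSidedIdeal.prod_le_right _ _ hqc
      have e1 : α.ap (g * h) (p * q) (TwoSidedIdeal.prod_le_right _ _ h1) =
          α.ap (g * h) p hp1 * α.ap (g * h) q hq1 := α.ap_mul _ _ _ _ _ _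
      have e2 : α.ap (g * h) (p * q * c) (TwoSidedIdeal.prod_le_right _ _ h2) =
          α.ap (g * h) p hp1 * α.ap (g * h) (q * c) hqc1 := by
        rw [← α.ap_mul (g * h) p (q * c) hp1 hqc1 (TwoSidedIdeal.mul_mem_right _ _ _ hp1)]
        exact α.ap_congr _ (mul_assoc _ _ _) _ _
      have e1' := (lact_congr (α.w g h) e1 (α.ap_mul_mem h1)
        (TwoSidedIdeal.mul_mem_right _ _ _ (α.ap_mul_mem hp))).trans
        (lact_mul (α.w g h) _ _ (α.ap_mul_mem hp) (α.ap_mul_mem hq) _)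
      have e2' := (lact_congr (α.w g h) e2 (α.ap_mul_mem h2)
        (TwoSidedIdeal.mul_mem_right _ _ _ (α.ap_mul_mem hp))).trans
        (lact_mul (α.w g h) _ _ (α.ap_mul_mem hp) (α.ap_mul_mem hqc) _)
      rw [e2', α.core_congr e1' _ (TwoSidedIdeal.mul_mem_left _ _ _ (α.ap_mem _ _ _)),
        α.core_mul_left (α.ap_mem _ _ _), α.core_ap]
    · intro h1 h2
      have e1 : lact (α.w g h) (α.ap (g * h) 0 (TwoSidedIdeal.prod_le_right _ _ h1))
          (α.ap_mul_mem h1) = 0 :=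
        (lact_congr _ (α.ap_zero _ _) _ (TwoSidedIdeal.zero_mem _)).trans (lact_zero _ _)
      have e2 : lact (α.w g h) (α.ap (g * h) (0 * c) (TwoSidedIdeal.prod_le_right _ _ h2))
          (α.ap_mul_mem h2) = 0 :=
        (lact_congr _ ((α.ap_congr _ (zero_mul c) _ (TwoSidedIdeal.zero_mem _)).trans
          (α.ap_zero _ _)) _ (TwoSidedIdeal.zero_mem _)).trans (lact_zero _ _)
      rw [e2, α.core_congr e1 _ (TwoSidedIdeal.zero_mem _), core_zero_left]
    · intro p hp q hq hp' hq' h1 h2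
      have hp0 := TwoSidedIdeal.prod_le_left _ _ hp
      have hq0 := TwoSidedIdeal.prod_le_left _ _ hq
      have hpc := TwoSidedIdeal.mul_mem_right _ _ c hp0
      have hqc := TwoSidedIdeal.mul_mem_right _ _ c hq0
      have e1 := (lact_congr (α.w g h) (α.ap_add (g * h) p q
          (TwoSidedIdeal.prod_le_right _ _ hp0) (TwoSidedIdeal.prod_le_right _ _ hq0)
          (TwoSidedIdeal.prod_le_right _ _ h1)) (α.ap_mul_mem h1)
          (TwoSidedIdeal.add_mem _ (α.ap_mul_mem hp0) (α.ap_mul_mem hq0))).trans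
        (lact_add (α.w g h) _ _ (α.ap_mul_mem hp0) (α.ap_mul_mem hq0) _)
      have e2 := (lact_congr (α.w g h) ((α.ap_congr (g * h) (add_mul p q c)
          (TwoSidedIdeal.prod_le_right _ _ h2) (TwoSidedIdeal.prod_le_right _ _
            (TwoSidedIdeal.add_mem _ hpc hqc))).trans (α.ap_add (g * h) _ _
          (TwoSidedIdeal.prod_le_right _ _ hpc) (TwoSidedIdeal.prod_le_right _ _ hqc) _))
          (α.ap_mul_mem h2)
          (TwoSidedIdeal.add_mem _ (α.ap_mul_mem hpc) (α.ap_mul_mem hqc))).trans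
        (lact_add (α.w g h) _ _ (α.ap_mul_mem hpc) (α.ap_mul_mem hqc) _)
      rw [e2, α.core_congr e1 _ (TwoSidedIdeal.add_mem _
          (TwoSidedIdeal.prod_le_right _ _ (lact_mem _ _ _))
          (TwoSidedIdeal.prod_le_right _ _ (lact_mem _ _ _))),
        α.core_add_left (TwoSidedIdeal.prod_le_right _ _ (lact_mem _ _ _))
          (TwoSidedIdeal.prod_le_right _ _ (lact_mem _ _ _)), hp' hp0 hpc, hq' hq0 hqc]
    · intro p hp hp' h1 h2
      have hp0 := TwoSidedIdeal.prod_le_left _ _ hp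
      have hpc := TwoSidedIdeal.mul_mem_right _ _ c hp0
      have e1 := (lact_congr (α.w g h) (α.ap_neg (g * h) p
          (TwoSidedIdeal.prod_le_right _ _ hp0)
          (TwoSidedIdeal.prod_le_right _ _ h1)) (α.ap_mul_mem h1)
          (TwoSidedIdeal.neg_mem _ (α.ap_mul_mem hp0))).trans
        (lact_neg (α.w g h) _ (α.ap_mul_mem hp0) _)
      have e2 := (lact_congr (α.w g h) ((α.ap_congr (g * h) (neg_mul p c)
          (TwoSidedIdeal.prod_le_right _ _ h2) (TwoSidedIdeal.prod_le_right _ _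
            (TwoSidedIdeal.neg_mem _ hpc))).trans (α.ap_neg (g * h) _
          (TwoSidedIdeal.prod_le_right _ _ hpc) _))
          (α.ap_mul_mem h2) (TwoSidedIdeal.neg_mem _ (α.ap_mul_mem hpc))).trans
        (lact_neg (α.w g h) _ (α.ap_mul_mem hpc) _)
      rw [e2, α.core_congr e1 _ (TwoSidedIdeal.neg_mem _
          (TwoSidedIdeal.prod_le_right _ _ (lact_mem _ _ _))),
        α.core_neg_left (TwoSidedIdeal.prod_le_right _ _ (lact_mem _ _ _)), hp' hp0 hpc]
  exact key hz hzc

theorem core_ract {g h : G} {b c : A} (hb : b ∈ α.D g⁻¹ * α.D h)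
    (hx : α.core h b c (TwoSidedIdeal.prod_le_right _ _ hb) ∈ α.D g⁻¹)
    (hx' : α.ap g _ hx ∈ α.D g * α.D (g * h)) :
    α.core (g * h) (ract (α.w g h) (α.ap g b (TwoSidedIdeal.prod_le_left _ _ hb))
        (α.ap_mem_prod g h _ hb)) c (TwoSidedIdeal.prod_le_right _ _ (ract_mem _ _ _)) =
      ract (α.w g h) (α.ap g _ hx) hx' := by
  have hbh := TwoSidedIdeal.prod_le_right _ _ hb
  have hz : α.apInv h b hbh ∈ α.D h⁻¹ * α.D (g * h)⁻¹ := by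
    apply α.apInv_mem_prod h (g * h)⁻¹ hbh
    rw [show h * (g * h)⁻¹ = g⁻¹ by group, α.D_comm]
    exact hb
  have hzc : α.apInv h b hbh * c ∈ α.D h⁻¹ * α.D (g * h)⁻¹ :=
    TwoSidedIdeal.mul_mem_right _ _ _ hz
  have e1 : α.ap g b (TwoSidedIdeal.prod_le_left _ _ hb) = _ :=
    (α.ap_congr g (α.ap_apInv h b hbh).symm _ (α.ap_mem_inv hz)).trans (α.comp_eq g h _ hz)
  have e2 : α.ap g _ hx = _ := α.comp_eq g h _ hzc
  rw [α.core_congr ((ract_congr (α.w g h) e1 _ (ract_mem _ _ _)).trans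
      (ract_inv_ract _ _ (lact_mem _ _ _))) _
      (TwoSidedIdeal.prod_le_right _ _ (lact_mem _ _ _)),
    (ract_congr (α.w g h) e2 hx' (ract_mem _ _ _)).trans
      (ract_inv_ract _ _ (lact_mem _ _ _))]
  exact α.lact_core hz hzc

theorem coeff_assoc (g h t : G) (a b c : A) (ha : a ∈ α.D g) (hb : b ∈ α.D h) (hc : c ∈ α.D t) :
    α.coeff (g * h) t (α.coeff g h a b ha hb) c (α.coeff_mem ha hb) hc =
      α.coeff g (h * t) a (α.coeff h t b c hb hc) ha (α.coeff_mem hb hc) := by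
  have hx := α.core_mem hb hc
  have hy : α.apInv g a ha * b ∈ α.D g⁻¹ * α.D h := α.apInv_mul_mem ha hb
  have hax : α.apInv g a ha * α.core h b c hb ∈ α.D g⁻¹ * α.D h * α.D (h * t) := by
    rw [TwoSidedIdeal.prod_assoc]
    exact TwoSidedIdeal.prod_mem_prod (α.apInv_mem g a ha) hx
  have e1 : α.apInv g a ha * α.coeff h t b c hb hc =
      ract (α.w h t) (α.apInv g a ha * α.core h b c hb) (α.triple_le_snd_thd _ _ _ hax) :=
    mul_ract _ (α.pair_idem _ _) _ _ hx _
  have e2 : α.core g a (α.coeff h t b c hb hc) ha = α.apRact (α.w h t) _ hax :=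
    α.ap_congr g e1 _ _
  have e3 : α.coeff g (h * t) a (α.coeff h t b c hb hc) ha (α.coeff_mem hb hc) = _ :=
    (ract_congr (α.w g (h * t)) e2 _ (α.apRact_mem (α.w h t) hax)).trans (α.cocycle g h t _ hax)
  rw [e3]
  have e4 := α.core_mul_left (r := α.apInv g a ha) (b := c) hb
    (TwoSidedIdeal.mul_mem_left _ _ _ hb)
  have hx1 : α.core h (α.apInv g a ha * b) c (TwoSidedIdeal.prod_le_right _ _ hy) ∈ α.D g⁻¹ := by
    rw [e4]; exact α.triple_le_fst _ _ _ hax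
  have e5 : α.ap g _ hx1 = α.ap g _ (α.triple_le_fst _ _ _ hax) := α.ap_congr g e4 _ _
  have hx2 : α.ap g _ hx1 ∈ α.D g * α.D (g * h) := by
    rw [e5]; exact α.triple_le_fst_snd _ _ _ (α.ap_mem_triple' hax)
  have e6 := α.core_ract hy hx1 hx2
  exact ract_congr _ (e6.trans (ract_congr _ e5 _ _)) _ _

theorem coeff_add_left {g h : G} {a a' b : A} (ha : a ∈ α.D g) (ha' : a' ∈ α.D g)
    (haa : a + a' ∈ α.D g) (hb : b ∈ α.D h) :
    α.coeff g h (a + a') b haa hb = α.coeff g h a b ha hb + α.coeff g h a' b ha' hb :=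
  (ract_congr _ (α.core_add_left ha ha' haa) _
    (TwoSidedIdeal.add_mem _ (α.core_mem ha hb) (α.core_mem ha' hb))).trans
    (ract_add _ _ _ (α.core_mem ha hb) (α.core_mem ha' hb) _)

theorem coeff_add_right {g h : G} {a b b' : A} (ha : a ∈ α.D g) (hb : b ∈ α.D h)
    (hb' : b' ∈ α.D h) (hbb : b + b' ∈ α.D h) :
    α.coeff g h a (b + b') ha hbb = α.coeff g h a b ha hb + α.coeff g h a b' ha hb' :=
  (ract_congr _ (α.core_add_right ha) _
    (TwoSidedIdeal.add_mem _ (α.core_mem ha hb) (α.core_mem ha hb'))).trans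
    (ract_add _ _ _ (α.core_mem ha hb) (α.core_mem ha hb') _)

/-- The multiplication of homogeneous components, as a biadditive map. -/
def mulComponent (g h : G) : α.D g →+ α.D h →+ α.D (g * h) :=
  AddMonoidHom.mk' (fun a => AddMonoidHom.mk'
      (fun b => ⟨α.coeff g h a b a.2 b.2, α.coeff_mem a.2 b.2⟩)
      (fun b b' => Subtype.ext (α.coeff_add_right a.2 b.2 b'.2 (b + b').2)))
    (fun a a' => AddMonoidHom.ext fun b =>
      Subtype.ext (α.coeff_add_left a.2 a'.2 (a + a').2 b.2))

/-- The crossed product of the twisted partial action `α` on `A` by `G`: the direct sum of the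
`D g`, with multiplication `(a δ g) (b δ h) = α g ((α g)⁻¹ a * b) w g h δ (g * h)`. -/
def CrossedProduct : Type (max u w) := DirectSum G fun g => α.D g

namespace CrossedProduct

noncomputable instance instAddCommGroup : AddCommGroup α.CrossedProduct :=
  inferInstanceAs (AddCommGroup (DirectSum G fun g => α.D g))

open Classical in
/-- The element `a δ g`. -/
noncomputable def single (g : G) : α.D g →+ α.CrossedProduct :=
  DirectSum.of (fun g => α.D g) g

open Classical in
theorem hom_ext {M : Type*} [AddMonoid M] {f f' : α.CrossedProduct →+ M}
    (h : ∀ g a, f (single α g a) = f' (single α g a)) : f = f' :=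
  DirectSum.addHom_ext (β := fun g => α.D g) h

open Classical in
/-- The multiplication as a biadditive map. -/
noncomputable def mulHom : α.CrossedProduct →+ α.CrossedProduct →+ α.CrossedProduct :=
  DirectSum.toAddMonoid (β := fun g => α.D g) fun g =>
    AddMonoidHom.flip <| DirectSum.toAddMonoid (β := fun g => α.D g) fun h =>
      AddMonoidHom.flip <| (single α (g * h)).compHom.comp (α.mulComponent g h)

theorem mulHom_single (g h : G) (a : α.D g) (b : α.D h) :
    mulHom α (single α g a) (single α h b) = single α (g * h) (α.mulComponent g h a b) := by
  classical
  let f : ∀ g : G, α.D g →+ α.CrossedProduct →+ α.CrossedProduct := fun g =>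
    AddMonoidHom.flip <| DirectSum.toAddMonoid (β := fun g => α.D g) fun h =>
      AddMonoidHom.flip <| (single α (g * h)).compHom.comp (α.mulComponent g h)
  have h1 : mulHom α (single α g a) = f g a := by
    exact DirectSum.toAddMonoid_of (β := fun g => α.D g) f g a
  have h2 : f g a (single α h b) = single α (g * h) (α.mulComponent g h a b) := by
    let f' : ∀ h : G, α.D h →+ α.D g →+ α.CrossedProduct := fun h =>
      AddMonoidHom.flip <| (single α (g * h)).compHom.comp (α.mulComponent g h)
    have h3 : DirectSum.toAddMonoid (β := fun g => α.D g) f' (single α h b) = f' h b := by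
      exact DirectSum.toAddMonoid_of (β := fun g => α.D g) f' h b
    exact DFunLike.congr_fun h3 a
  rw [h1, h2]

theorem single_congr {g g' : G} (h : g = g') (a : α.D g) (a' : α.D g') (ha : (a : A) = a') :
    single α g a = single α g' a' := by
  subst h
  rw [Subtype.ext ha]

open Classical in
theorem induction {p : α.CrossedProduct → Prop} (h0 : p 0) (h1 : ∀ g a, p (single α g a))
    (h2 : ∀ x y, p x → p y → p (x + y)) (x : α.CrossedProduct) : p x :=
  DirectSum.induction_on (β := fun g => α.D g) (motive := p) x h0 h1 h2

theorem mulHom_assoc (x y z : α.CrossedProduct) :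
    mulHom α (mulHom α x y) z = mulHom α x (mulHom α y z) := by
  induction x using induction with
  | h0 => simp
  | h2 x x' hx hx' => simp [hx, hx']
  | h1 g a =>
    induction y using induction with
    | h0 => simp
    | h2 y y' hy hy' => simp [hy, hy']
    | h1 h b =>
      induction z using induction with
      | h0 => simp
      | h2 z z' hz hz' => simp [hz, hz']
      | h1 t c =>
        simp only [mulHom_single]
        exact single_congr α (mul_assoc g h t) _ _
          (α.coeff_assoc g h t a b c a.2 b.2 c.2)

noncomputable instance instNonUnitalRing : NonUnitalRing α.CrossedProduct :=
  { instAddCommGroup α with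
    mul := fun x y => mulHom α x y
    left_distrib := fun x y z => (mulHom α x).map_add y z
    right_distrib := fun x y z => by
      change mulHom α (x + y) z = mulHom α x z + mulHom α y z
      rw [map_add]; rfl
    zero_mul := fun x => by
      change mulHom α 0 x = 0
      rw [map_zero]; rfl
    mul_zero := fun x => (mulHom α x).map_zero
    mul_assoc := mulHom_assoc α }

/-- `(a δ g) (b δ h) = α g ((α g)⁻¹ a * b) w g h δ (g * h)` -/
theorem single_mul_single (g h : G) (a : α.D g) (b : α.D h) :
    single α g a * single α h b =
      single α (g * h) ⟨α.coeff g h a b a.2 b.2, α.coeff_mem a.2 b.2⟩ :=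
  mulHom_single α g h a b

end CrossedProduct

end TwistedPartialAction

/-! ### Globalizations -/

/-- The ring `A` is left `s`-unital. -/
def IsLeftSUnital (A : Type u) [NonUnitalRing A] : Prop := ∀ a : A, ∃ e : A, e * a = a

open Multiplier in
/-- `φ` embeds `A` into `B` in such a way that the twisted partial action `β` on `B`, which is
global, is a globalization of the twisted partial action `α` on `A`. -/
structure IsGlobalizationVia {G : Type w} [Group G] {A : Type u} [NonUnitalRing A]
    {B : Type v} [NonUnitalRing B] (α : TwistedPartialAction G A) (β : TwistedPartialAction G B)
    (φ : A →ₙ+* B) : Prop where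
  isGlobal : β.IsGlobal
  injective : Function.Injective φ
  mul_mem_left : ∀ (b : B) (a : A), b * φ a ∈ Set.range φ
  mul_mem_right : ∀ (b : B) (a : A), φ a * b ∈ Set.range φ
  /-- `B` is the sum of the images `β g (φ A)` -/
  sum_eq_top : AddSubgroup.closure
    {b : B | ∃ (g : G) (a : A), b = β.ap g (φ a) (isGlobal.mem _ _)} = ⊤
  image_D : ∀ g : G, φ '' {a | a ∈ α.D g} =
    Set.range φ ∩ {b | ∃ a : A, b = β.ap g (φ a) (isGlobal.mem _ _)}
  map_α : ∀ (g : G) (a : A) (ha : a ∈ α.D g⁻¹),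
    φ (α.ap g a ha) = β.ap g (φ a) (isGlobal.mem _ _)
  map_ract : ∀ (g h : G) (a : A) (ha : a ∈ α.D g * α.D (g * h)),
    φ (ract (α.w g h) a ha) = ract (β.w g h) (φ a) (isGlobal.mem_prod _ _ _)
  map_lact : ∀ (g h : G) (a : A) (ha : a ∈ α.D g * α.D (g * h)),
    φ (lact (α.w g h) a ha) = lact (β.w g h) (φ a) (isGlobal.mem_prod _ _ _)

/-- `β` is a globalization of `α`. -/
def IsGlobalization {G : Type w} [Group G] {A : Type u} [NonUnitalRing A]
    {B : Type v} [NonUnitalRing B] (α : TwistedPartialAction G A)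
    (β : TwistedPartialAction G B) : Prop :=
  ∃ φ : A →ₙ+* B, IsGlobalizationVia α β φ

/-! ### Morita equivalence of idempotent rings -/

/-- The ring `R` is idempotent: `R ^ 2 = R`. -/
def IsIdempotentRing (R : Type u) [NonUnitalRing R] : Prop :=
  AddSubgroup.closure {z : R | ∃ a b : R, z = a * b} = ⊤

/-- A left action of the ring `R` (without unit) on the abelian group `M` is unitary if
`R M = M`. -/
def IsUnitaryAction {R : Type u} {M : Type v} [NonUnitalNonAssocSemiring R] [AddCommGroup M]
    (act : R →ₙ+* AddMonoid.End M) : Prop :=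
  AddSubgroup.closure {z : M | ∃ (r : R) (m : M), z = act r m} = ⊤

/-- The unitary torsion-free left modules over the ring `R`: abelian groups `M` with an action of
`R` such that `R M = M`, and `R m = 0` only for `m = 0`. -/
structure UnitaryTorsionFreeModule (R : Type u) [NonUnitalRing R] where
  carrier : Type x
  [addCommGroup : AddCommGroup carrier]
  /-- the module structure -/
  act : R →ₙ+* AddMonoid.End carrier
  unitary : IsUnitaryAction act
  torsionFree : ∀ m : carrier, (∀ r : R, act r m = 0) → m = 0

namespace UnitaryTorsionFreeModule

attribute [instance] UnitaryTorsionFreeModule.addCommGroup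

variable {R : Type u} [NonUnitalRing R]

/-- `R`-linear maps. -/
@[ext]
structure Hom (M N : UnitaryTorsionFreeModule.{u, x} R) where
  toFun : M.carrier →+ N.carrier
  map_act : ∀ (r : R) (m : M.carrier), toFun (M.act r m) = N.act r (toFun m)

instance instCategory : CategoryTheory.Category (UnitaryTorsionFreeModule.{u, x} R) where
  Hom M N := Hom M N
  id M := ⟨AddMonoidHom.id _, fun _ _ => rfl⟩
  comp f g := ⟨g.toFun.comp f.toFun, fun r m => by simp [f.map_act, g.map_act]⟩

end UnitaryTorsionFreeModule

/-- Two idempotent rings are Morita equivalent if their categories of unitary torsion-free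
left modules are equivalent. -/
structure IsMoritaEquivalentIdempotent (R : Type u) (S : Type v) [NonUnitalRing R]
    [NonUnitalRing S] : Prop where
  idem_left : IsIdempotentRing R
  idem_right : IsIdempotentRing S
  equivalent : Nonempty (CategoryTheory.Equivalence
    (UnitaryTorsionFreeModule.{u, max u v} R) (UnitaryTorsionFreeModule.{v, max u v} S))

/-- A Morita context `(R, S, M, N, τ, τ')` with unitary bimodules. Right actions are actions of the
opposite ring, and the bimodule maps `τ : M ⊗[S] N → R` and `τ' : N ⊗[R] M → S` are given as
balanced biadditive maps. -/
structure MoritaContext (R : Type u) (S : Type v) [NonUnitalRing R] [NonUnitalRing S] where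
  M : Type x
  N : Type y
  [addCommGroupM : AddCommGroup M]
  [addCommGroupN : AddCommGroup N]
  /-- `r m` -/
  leftM : R →ₙ+* AddMonoid.End M
  /-- `m s` -/
  rightM : Sᵐᵒᵖ →ₙ+* AddMonoid.End M
  /-- `s n` -/
  leftN : S →ₙ+* AddMonoid.End N
  /-- `n r` -/
  rightN : Rᵐᵒᵖ →ₙ+* AddMonoid.End N
  commM : ∀ r s m, rightM (.op s) (leftM r m) = leftM r (rightM (.op s) m)
  commN : ∀ s r n, rightN (.op r) (leftN s n) = leftN s (rightN (.op r) n)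
  leftM_unitary : IsUnitaryAction leftM
  rightM_unitary : IsUnitaryAction rightM
  leftN_unitary : IsUnitaryAction leftN
  rightN_unitary : IsUnitaryAction rightN
  τ : M →+ N →+ R
  τ' : N →+ M →+ S
  τ_balanced : ∀ m s n, τ (rightM (.op s) m) n = τ m (leftN s n)
  τ_left : ∀ r m n, τ (leftM r m) n = r * τ m n
  τ_right : ∀ m n r, τ m (rightN (.op r) n) = τ m n * r
  τ'_balanced : ∀ n r m, τ' (rightN (.op r) n) m = τ' n (leftM r m)
  τ'_left : ∀ s n m, τ' (leftN s n) m = s * τ' n m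
  τ'_right : ∀ n m s, τ' n (rightM (.op s) m) = τ' n m * s
  /-- `τ(m ⊗ n) m' = m τ'(n ⊗ m')` -/
  assocM : ∀ m n m', leftM (τ m n) m' = rightM (.op (τ' n m')) m
  /-- `τ'(n ⊗ m) n' = n τ(m ⊗ n')` -/
  assocN : ∀ n m n', leftN (τ' n m) n' = rightN (.op (τ m n')) n

/-- Both maps of the Morita context are surjective. -/
def MoritaContext.IsSurjective {R : Type u} {S : Type v} [NonUnitalRing R] [NonUnitalRing S]
    (C : MoritaContext.{u, v, x, y} R S) : Prop :=
  AddSubgroup.closure {r : R | ∃ m n, r = C.τ m n} = ⊤ ∧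
    AddSubgroup.closure {s : S | ∃ n m, s = C.τ' n m} = ⊤

/-!
The theorem holds because the crossed product `S = B ⋊ G` of the globalization contains
`R = A ⋊ G` together with a right ideal and a left ideal that link the two rings. Regard `A` as an
ideal of `B`. The embedding of `A` into `B` induces an embedding of `R` into `S` (`embedding`). Let
`M` be the right ideal of the elements of `S` with all coefficients in `A` (`rightIdeal`), and `N`
the left ideal of the elements whose coefficient at `g` lies in `β g A` (`leftIdeal`). Then

* `R ⊆ M ∩ N`, and `M N ⊆ R`, since the coefficients at `g` of the elements of `M N` are in
  `A ∩ β g A = D g`; if `e a = a`, then `a δ g = (e δ 1) (a δ g)`, so that `R M = M`, `N R = N` (by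
  applying `β g`) and `M N = R`;
* `N M = S`, because `(β g a δ g) (b δ k) = β g (a b) u g k δ (g k)`, where `β g A u g k = β g A`,
  and the `β g A` span `B`.

Hence `M`, `N` and the multiplication of `S` form a surjective Morita context
(`IsMoritaEmbedding.context`).

A surjective Morita context gives an equivalence between the categories of unitary torsion-free
modules (`MoritaContext.IsSurjective.equivalence`). The functor sends `X` to the quotient of
`N ⊗[R] X` by its torsion. This quotient is the group of maps from `M` to `X` generated by
`m ↦ τ(m, n) x`, on which `S` acts by `(s f) m = f (m s)`, and in this form no tensor products are
needed. The functor back is that of the context with the two rings exchanged, and `X` is identified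
with its image under the composite by `x ↦ (n ↦ n ⊗ x)`. This map is injective because `X` is
torsion-free, and its range is the whole image because `X` is unitary and
`τ(m, n') x ↦ m ⊗ (n' ⊗ x)`.
-/

/-! ### The Morita theorem for surjective Morita contexts -/

theorem AddSubgroup.mem_closure_of_injective {H : Type*} {K : Type*} [AddGroup H] [AddGroup K]
    {f : H →+ K} (hf : Function.Injective f) {P : Set H} {z : H}
    (hz : f z ∈ AddSubgroup.closure (f '' P)) : z ∈ AddSubgroup.closure P := by
  rw [← AddMonoidHom.map_closure] at hz
  exact (AddSubgroup.mem_map_iff_mem hf).1 hz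

/-- A subgroup of `M` is everything as soon as it contains all `r m`, if the action is unitary. -/
theorem IsUnitaryAction.induction {R : Type*} {M : Type*} [NonUnitalNonAssocSemiring R]
    [AddCommGroup M] {act : R →ₙ+* AddMonoid.End M} (h : IsUnitaryAction act) (P : AddSubgroup M)
    (hP : ∀ r m, act r m ∈ P) (m : M) : m ∈ P := by
  have h1 : (⊤ : AddSubgroup M) ≤ P := by
    rw [← h, AddSubgroup.closure_le]
    rintro _ ⟨r, m, rfl⟩
    exact hP r m
  exact h1 trivial

theorem UnitaryTorsionFreeModule.act_mul {R : Type u} [NonUnitalRing R]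
    (X : UnitaryTorsionFreeModule.{u, x} R) (r r' : R) (a : X.carrier) :
    X.act (r * r') a = X.act r (X.act r' a) := by
  rw [map_mul]; rfl

namespace MoritaContext

open CategoryTheory

attribute [instance] MoritaContext.addCommGroupM MoritaContext.addCommGroupN

section

variable {R : Type u} {S : Type v} [NonUnitalRing R] [NonUnitalRing S]

/-- The Morita context with the roles of the two rings exchanged. -/
def symm (C : MoritaContext.{u, v, x, y} R S) : MoritaContext.{v, u, y, x} S R where
  M := C.N
  N := C.M
  leftM := C.leftN
  rightM := C.rightN
  leftN := C.leftM
  rightN := C.rightM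
  commM := C.commN
  commN := C.commM
  leftM_unitary := C.leftN_unitary
  rightM_unitary := C.rightN_unitary
  leftN_unitary := C.leftM_unitary
  rightN_unitary := C.rightM_unitary
  τ := C.τ'
  τ' := C.τ
  τ_balanced n r m := C.τ'_balanced n r m
  τ_left := C.τ'_left
  τ_right := C.τ'_right
  τ'_balanced m s n := C.τ_balanced m s n
  τ'_left := C.τ_left
  τ'_right := C.τ_right
  assocM := C.assocN
  assocN := C.assocM

theorem IsSurjective.symm {C : MoritaContext.{u, v, x, y} R S} (hC : C.IsSurjective) :
    C.symm.IsSurjective := And.symm hC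

/-- Since `R = τ(M, N) = τ(R M, N) = R τ(M, N)`, the ring `R` is idempotent. -/
theorem IsSurjective.isIdempotentRing {C : MoritaContext.{u, v, x, y} R S}
    (hC : C.IsSurjective) : IsIdempotentRing R := by
  refine top_le_iff.1 ?_
  rw [← hC.1, AddSubgroup.closure_le]
  rintro _ ⟨m, n, rfl⟩
  refine C.leftM_unitary.induction
    ((AddSubgroup.closure {z : R | ∃ a b : R, z = a * b}).comap (C.τ.flip n)) ?_ m
  intro r m
  exact AddSubgroup.subset_closure ⟨r, C.τ m n, C.τ_left r m n⟩

end

section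

variable {R : Type u} {S : Type v} [NonUnitalRing R] [NonUnitalRing S]
  (C : MoritaContext.{u, v, x, x} R S)

/-- The map `m ↦ τ(m, n) a` from `M` to the left `R`-module `X`, for `n ∈ N` and `a ∈ X`. -/
def pairing (X : UnitaryTorsionFreeModule.{u, max x y} R) :
    C.N →+ X.carrier →+ (C.M →+ X.carrier) :=
  AddMonoidHom.mk' (fun n => AddMonoidHom.mk' (fun a => AddMonoidHom.mk'
      (fun m => X.act (C.τ m n) a)
      (fun m m' => by rw [map_add, AddMonoidHom.add_apply, map_add]; rfl))
      (fun a a' => by ext m; exact map_add (X.act (C.τ m n)) a a'))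
    (fun n n' => by
      ext a m
      change X.act (C.τ m (n + n')) a = X.act (C.τ m n) a + X.act (C.τ m n') a
      rw [map_add, map_add]; rfl)

/-- The additive group generated by the maps `m ↦ τ(m, n) a`. It is the image of `N ⊗[R] X` in the
group of additive maps from `M` to `X`, that is, the quotient of `N ⊗[R] X` by its torsion. -/
def imageGroup (X : UnitaryTorsionFreeModule.{u, max x y} R) : AddSubgroup (C.M →+ X.carrier) :=
  AddSubgroup.closure {f | ∃ n a, f = C.pairing X n a}

/-- The additive map `f ↦ (m ↦ f (m s))`. -/
def precompRight (X : UnitaryTorsionFreeModule.{u, max x y} R) (s : S) :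
    (C.M →+ X.carrier) →+ (C.M →+ X.carrier) :=
  AddMonoidHom.mk' (fun f => f.comp (C.rightM (.op s))) (fun f g => AddMonoidHom.add_comp f g _)

theorem precompRight_pairing (X : UnitaryTorsionFreeModule.{u, max x y} R) (s : S) (n : C.N)
    (a : X.carrier) : C.precompRight X s (C.pairing X n a) = C.pairing X (C.leftN s n) a := by
  ext m
  change X.act (C.τ (C.rightM (.op s) m) n) a = X.act (C.τ m (C.leftN s n)) a
  rw [C.τ_balanced]

theorem precompRight_mem (X : UnitaryTorsionFreeModule.{u, max x y} R) (s : S)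
    {f : C.M →+ X.carrier} (hf : f ∈ C.imageGroup X) :
    C.precompRight X s f ∈ C.imageGroup X := by
  have h : C.imageGroup X ≤ (C.imageGroup X).comap (C.precompRight X s) := by
    refine (AddSubgroup.closure_le _).2 ?_
    rintro _ ⟨n, a, rfl⟩
    refine AddSubgroup.mem_comap.2 ?_
    rw [precompRight_pairing]
    exact AddSubgroup.subset_closure ⟨_, _, rfl⟩
  exact h hf

/-- The element `m ↦ τ(m, n) a` of `C.imageGroup X`; it is the class of `n ⊗ a`. -/
def tmul (X : UnitaryTorsionFreeModule.{u, max x y} R) :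
    C.N →+ X.carrier →+ C.imageGroup X :=
  AddMonoidHom.mk' (fun n => AddMonoidHom.mk'
      (fun a => ⟨C.pairing X n a, AddSubgroup.subset_closure ⟨n, a, rfl⟩⟩)
      (fun a a' => Subtype.ext (map_add (C.pairing X n) a a')))
    (fun n n' => AddMonoidHom.ext fun a => Subtype.ext (by
      change C.pairing X (n + n') a = C.pairing X n a + C.pairing X n' a
      rw [map_add]; rfl))

theorem closure_tmul (X : UnitaryTorsionFreeModule.{u, max x y} R) :
    AddSubgroup.closure {f | ∃ n a, f = C.tmul X n a} = ⊤ := by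
  refine top_le_iff.1 fun f _ => ?_
  refine AddSubgroup.mem_closure_of_injective (f := (C.imageGroup X).subtype)
    Subtype.val_injective ?_
  refine AddSubgroup.closure_mono ?_ f.2
  rintro _ ⟨n, a, rfl⟩
  exact ⟨C.tmul X n a, ⟨n, a, rfl⟩, rfl⟩

theorem tmul_induction {X : UnitaryTorsionFreeModule.{u, max x y} R}
    (P : AddSubgroup (C.imageGroup X)) (h : ∀ n a, C.tmul X n a ∈ P) (f : C.imageGroup X) :
    f ∈ P := by
  have h1 : (⊤ : AddSubgroup (C.imageGroup X)) ≤ P := by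
    rw [← C.closure_tmul, AddSubgroup.closure_le]
    rintro _ ⟨n, a, rfl⟩
    exact h n a
  exact h1 trivial

/-- The action `(s f) m = f (m s)` of `S` on `C.imageGroup X`. -/
def imageAct (X : UnitaryTorsionFreeModule.{u, max x y} R) :
    S →ₙ+* AddMonoid.End (C.imageGroup X) where
  toFun s := AddMonoidHom.mk' (fun f => ⟨C.precompRight X s f, C.precompRight_mem X s f.2⟩)
    (fun f g => Subtype.ext (map_add (C.precompRight X s) f.1 g.1))
  map_mul' s t := by
    ext f m
    change f.1 (C.rightM (.op (s * t)) m) = f.1 (C.rightM (.op t) (C.rightM (.op s) m))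
    rw [MulOpposite.op_mul, map_mul]; rfl
  map_zero' := by
    ext f m
    change f.1 (C.rightM (.op 0) m) = 0
    rw [MulOpposite.op_zero, map_zero]
    exact map_zero f.1
  map_add' s t := by
    ext f m
    change f.1 (C.rightM (.op (s + t)) m) =
      f.1 (C.rightM (.op s) m) + f.1 (C.rightM (.op t) m)
    rw [MulOpposite.op_add, map_add]
    exact map_add f.1 _ _

theorem imageAct_tmul (X : UnitaryTorsionFreeModule.{u, max x y} R) (s : S) (n : C.N)
    (a : X.carrier) : C.imageAct X s (C.tmul X n a) = C.tmul X (C.leftN s n) a :=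
  Subtype.ext (C.precompRight_pairing X s n a)

/-- The unitary torsion-free `S`-module obtained from a unitary torsion-free `R`-module. -/
def obj (X : UnitaryTorsionFreeModule.{u, max x y} R) :
    UnitaryTorsionFreeModule.{v, max x y} S where
  carrier := C.imageGroup X
  act := C.imageAct X
  unitary := by
    refine top_le_iff.1 fun f _ => C.tmul_induction _ (fun n a => ?_) f
    refine C.leftN_unitary.induction ((AddSubgroup.closure {z : C.imageGroup X |
      ∃ (s : S) (f : C.imageGroup X), z = C.imageAct X s f}).comap ((C.tmul X).flip a))
      (fun s n => ?_) n
    exact AddSubgroup.subset_closure ⟨s, C.tmul X n a, (C.imageAct_tmul X s n a).symm⟩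
  torsionFree f hf := by
    refine Subtype.ext (AddMonoidHom.ext fun m => ?_)
    refine C.rightM_unitary.induction (AddMonoidHom.ker f.1) (fun s m => ?_) m
    exact DFunLike.congr_fun (congrArg Subtype.val (hf s.unop)) m

/-- The action of the functor `C.functor` on morphisms, by composition. -/
def mapHom {X Y : UnitaryTorsionFreeModule.{u, max x y} R} (f : X ⟶ Y) :
    C.imageGroup X →+ C.imageGroup Y :=
  AddMonoidHom.mk' (fun p => ⟨f.toFun.comp p.1, by
      have h : C.imageGroup X ≤ (C.imageGroup Y).comap (AddMonoidHom.compHom f.toFun) := by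
        refine (AddSubgroup.closure_le _).2 ?_
        rintro _ ⟨n, a, rfl⟩
        refine AddSubgroup.subset_closure ⟨n, f.toFun a, ?_⟩
        ext m
        exact f.map_act _ _
      exact h p.2⟩)
    (fun p q => Subtype.ext (AddMonoidHom.comp_add f.toFun p.1 q.1))

/-- The functor `X ↦ (N ⊗[R] X) / torsion`. -/
def functor :
    UnitaryTorsionFreeModule.{u, max x y} R ⥤ UnitaryTorsionFreeModule.{v, max x y} S where
  obj := C.obj
  map f := ⟨C.mapHom f, fun _ _ => rfl⟩
  map_id _ := rfl
  map_comp _ _ := rfl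

/-- The map `a ↦ (n ↦ n ⊗ a)`. -/
def unitMap (X : UnitaryTorsionFreeModule.{u, max x y} R) :
    X.carrier →+ (C.symm.M →+ (C.obj X).carrier) := (C.tmul X).flip

/-- `τ(m, n') a` is sent to `m ⊗ (n' ⊗ a)`. -/
theorem unitMap_act (X : UnitaryTorsionFreeModule.{u, max x y} R) (m : C.M) (n' : C.N)
    (a : X.carrier) : C.unitMap X (X.act (C.τ m n') a) =
      C.symm.pairing (C.obj X) m (C.tmul X n' a) := by
  refine AddMonoidHom.ext fun (n : C.N) => Subtype.ext (AddMonoidHom.ext fun m' => ?_)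
  change X.act (C.τ m' n) (X.act (C.τ m n') a) =
    X.act (C.τ (C.rightM (.op (C.τ' n m)) m') n') a
  rw [← C.assocM, C.τ_left, X.act_mul]

variable {C}

theorem IsSurjective.act_induction (hC : C.IsSurjective)
    {X : UnitaryTorsionFreeModule.{u, max x y} R} (P : AddSubgroup X.carrier)
    (h : ∀ m n a, X.act (C.τ m n) a ∈ P) (a : X.carrier) : a ∈ P := by
  refine X.unitary.induction P (fun r a => ?_) a
  have h1 : (⊤ : AddSubgroup R) ≤ P.comap
      ((AddMonoidHom.eval a).comp (X.act : R →+ AddMonoid.End X.carrier)) := by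
    rw [← hC.1, AddSubgroup.closure_le]
    rintro _ ⟨m, n, rfl⟩
    exact h m n a
  exact h1 trivial

theorem IsSurjective.unitMap_mem (hC : C.IsSurjective)
    (X : UnitaryTorsionFreeModule.{u, max x y} R) (a : X.carrier) :
    C.unitMap X a ∈ C.symm.imageGroup (C.obj X) := by
  refine hC.act_induction ((C.symm.imageGroup (C.obj X)).comap (C.unitMap X)) (fun m n a => ?_) a
  refine AddSubgroup.mem_comap.2 ?_
  rw [unitMap_act]
  exact AddSubgroup.subset_closure ⟨m, _, rfl⟩

/-- The map `a ↦ (n ↦ n ⊗ a)` is injective, as `τ(m, n) a = 0` for all `m` and `n` implies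
`R a = 0`. -/
theorem IsSurjective.unitMap_injective (hC : C.IsSurjective)
    (X : UnitaryTorsionFreeModule.{u, max x y} R) : Function.Injective (C.unitMap X) := by
  refine (injective_iff_map_eq_zero _).2 fun a ha => X.torsionFree a fun r => ?_
  have h1 : (⊤ : AddSubgroup R) ≤ AddMonoidHom.ker
      ((AddMonoidHom.eval a).comp (X.act : R →+ AddMonoid.End X.carrier)) := by
    rw [← hC.1, AddSubgroup.closure_le]
    rintro _ ⟨m, n, rfl⟩
    exact DFunLike.congr_fun (congrArg Subtype.val (DFunLike.congr_fun ha n)) m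
  exact h1 (x := r) trivial

theorem exists_unitMap_eq
    (X : UnitaryTorsionFreeModule.{u, max x y} R) (p : C.symm.imageGroup (C.obj X)) :
    ∃ a, C.unitMap X a = p.1 := by
  suffices h : C.symm.imageGroup (C.obj X) ≤ (C.unitMap X).range from h p.2
  refine (AddSubgroup.closure_le _).2 ?_
  rintro _ ⟨m, f, rfl⟩
  refine C.tmul_induction ((C.unitMap X).range.comap (C.symm.pairing (C.obj X) m))
    (fun n a => ?_) f
  exact ⟨_, C.unitMap_act X m n a⟩

/-- The additive isomorphism `a ↦ (n ↦ n ⊗ a)` from `X` onto the module obtained by going from `R`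
to `S` and back. -/
noncomputable def IsSurjective.unitEquiv (hC : C.IsSurjective)
    (X : UnitaryTorsionFreeModule.{u, max x y} R) :
    X.carrier ≃+ C.symm.imageGroup (C.obj X) :=
  AddEquiv.ofBijective ((C.unitMap X).codRestrict _ (hC.unitMap_mem X))
    ⟨fun _ _ h => hC.unitMap_injective X (congrArg Subtype.val h),
      fun p => (exists_unitMap_eq X p).imp fun _ h => Subtype.ext h⟩

theorem IsSurjective.unitEquiv_act (hC : C.IsSurjective)
    (X : UnitaryTorsionFreeModule.{u, max x y} R) (r : R) (a : X.carrier) :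
    hC.unitEquiv X (X.act r a) = C.symm.imageAct (C.obj X) r (hC.unitEquiv X a) := by
  refine Subtype.ext (AddMonoidHom.ext fun (n : C.N) =>
    Subtype.ext (AddMonoidHom.ext fun m => ?_))
  change X.act (C.τ m n) (X.act r a) = X.act (C.τ m (C.rightN (.op r) n)) a
  rw [C.τ_right, X.act_mul]

/-- Going from `R`-modules to `S`-modules and back is isomorphic to the identity. -/
noncomputable def IsSurjective.unitIso (hC : C.IsSurjective) :
    𝟭 (UnitaryTorsionFreeModule.{u, max x y} R) ≅ C.functor ⋙ C.symm.functor :=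
  NatIso.ofComponents
    (fun X =>
      { hom := ⟨(hC.unitEquiv X).toAddMonoidHom, hC.unitEquiv_act X⟩
        inv := ⟨(hC.unitEquiv X).symm.toAddMonoidHom, fun r p => by
          refine (hC.unitEquiv X).injective ?_
          refine ((hC.unitEquiv X).apply_symm_apply _).trans ?_
          refine Eq.trans ?_ (hC.unitEquiv_act X r _).symm
          exact congrArg (C.symm.imageAct (C.obj X) r)
            ((hC.unitEquiv X).apply_symm_apply p).symm⟩
        hom_inv_id := UnitaryTorsionFreeModule.Hom.ext (AddMonoidHom.ext
          (hC.unitEquiv X).symm_apply_apply)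
        inv_hom_id := UnitaryTorsionFreeModule.Hom.ext (AddMonoidHom.ext
          (hC.unitEquiv X).apply_symm_apply) })
    (fun {X Y} f => by
      refine UnitaryTorsionFreeModule.Hom.ext (AddMonoidHom.ext fun a => ?_)
      refine Subtype.ext (AddMonoidHom.ext fun n => Subtype.ext (AddMonoidHom.ext fun m => ?_))
      exact (f.map_act _ _).symm)

/-- The equivalence of module categories given by a surjective Morita context. -/
noncomputable def IsSurjective.equivalence (hC : C.IsSurjective) :
    UnitaryTorsionFreeModule.{u, max x y} R ≌ UnitaryTorsionFreeModule.{v, max x y} S :=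
  CategoryTheory.Equivalence.mk C.functor C.symm.functor hC.unitIso hC.symm.unitIso.symm

end

end MoritaContext

/-! ### Morita contexts inside a ring -/

section OfEmbedding

variable {R : Type u} {S : Type v} [NonUnitalRing R] [NonUnitalRing S]

/-- `ι` embeds the ring `R` into `S`, and `M` and `N` are a right and a left ideal of `S`, both
containing `R`, such that `M N = R`, `N M = S`, `R M = M` and `N R = N`. The last two equalities
are stated as the inclusions `M ⊆ R M` and `N ⊆ N R`, as the converse ones follow from `R ⊆ M ∩ N`;
`M S = M` and `S N = N` follow as well. -/
structure IsMoritaEmbedding (ι : R →ₙ+* S) (M N : AddSubgroup S) : Prop where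
  injective : Function.Injective ι
  mul_mem_M : ∀ m ∈ M, ∀ s, m * s ∈ M
  mul_mem_N : ∀ s, ∀ n ∈ N, s * n ∈ N
  map_mem_M : ∀ r, ι r ∈ M
  map_mem_N : ∀ r, ι r ∈ N
  mul_mem_range : ∀ m ∈ M, ∀ n ∈ N, m * n ∈ ι.range
  M_le : M ≤ AddSubgroup.closure {z | ∃ r, ∃ m ∈ M, z = ι r * m}
  N_le : N ≤ AddSubgroup.closure {z | ∃ r, ∃ n ∈ N, z = n * ι r}
  map_mem_closure : ∀ r, ι r ∈ AddSubgroup.closure {z | ∃ m ∈ M, ∃ n ∈ N, z = m * n}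
  closure_eq_top : AddSubgroup.closure {z | ∃ n ∈ N, ∃ m ∈ M, z = n * m} = ⊤

/-- The left action on an additive subgroup of a ring `S`, through a homomorphism to `S`. -/
def AddSubgroup.leftAct (f : R →ₙ+* S) (M : AddSubgroup S) (h : ∀ r, ∀ m ∈ M, f r * m ∈ M) :
    R →ₙ+* AddMonoid.End M where
  toFun r := AddMonoidHom.mk' (fun m => ⟨f r * m, h r m m.2⟩)
    (fun m m' => Subtype.ext (mul_add _ _ _))
  map_mul' r r' := AddMonoidHom.ext fun m => Subtype.ext (by
    change f (r * r') * m = f r * (f r' * m)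
    rw [map_mul, mul_assoc])
  map_zero' := AddMonoidHom.ext fun m => Subtype.ext (by
    change f 0 * (m : S) = 0
    rw [map_zero, zero_mul])
  map_add' r r' := AddMonoidHom.ext fun m => Subtype.ext (by
    change f (r + r') * m = f r * m + f r' * m
    rw [map_add, add_mul])

/-- The right action on an additive subgroup of a ring `S`, through a homomorphism to `S`. -/
def AddSubgroup.rightAct (f : R →ₙ+* S) (M : AddSubgroup S) (h : ∀ r, ∀ m ∈ M, m * f r ∈ M) :
    Rᵐᵒᵖ →ₙ+* AddMonoid.End M where
  toFun r := AddMonoidHom.mk' (fun m => ⟨m * f r.unop, h r.unop m m.2⟩)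
    (fun m m' => Subtype.ext (add_mul _ _ _))
  map_mul' r r' := AddMonoidHom.ext fun m => Subtype.ext (by
    change (m : S) * f (r'.unop * r.unop) = m * f r'.unop * f r.unop
    rw [map_mul, mul_assoc])
  map_zero' := AddMonoidHom.ext fun m => Subtype.ext (by
    change (m : S) * f 0 = 0
    rw [map_zero, mul_zero])
  map_add' r r' := AddMonoidHom.ext fun m => Subtype.ext (by
    change (m : S) * f (r.unop + r'.unop) = m * f r.unop + m * f r'.unop
    rw [map_add, mul_add])

theorem AddSubgroup.closure_eq_top_of_le {M : AddSubgroup S} {P : Set M} {Q : Set S}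
    (h : M ≤ AddSubgroup.closure Q) (hQ : Q ⊆ M.subtype '' P) : AddSubgroup.closure P = ⊤ :=
  top_le_iff.1 fun m _ => AddSubgroup.mem_closure_of_injective (f := M.subtype)
    Subtype.val_injective (AddSubgroup.closure_mono hQ (h m.2))

namespace IsMoritaEmbedding

variable {ι : R →ₙ+* S} {M N : AddSubgroup S} (h : IsMoritaEmbedding ι M N)

/-- The element of `R` whose image is the product `m n`. -/
noncomputable def preimage (m : M) (n : N) : R := (h.mul_mem_range m m.2 n n.2).choose

theorem map_preimage (m : M) (n : N) : ι (h.preimage m n) = m * n :=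
  (h.mul_mem_range m m.2 n n.2).choose_spec

/-- The Morita context given by `M`, `N` and the multiplication of `S`. -/
noncomputable def context : MoritaContext.{u, v, v, v} R S where
  M := M
  N := N
  leftM := AddSubgroup.leftAct ι M fun r m _ => h.mul_mem_M _ (h.map_mem_M r) m
  rightM := AddSubgroup.rightAct (NonUnitalRingHom.id S) M fun s m hm => h.mul_mem_M m hm s
  leftN := AddSubgroup.leftAct (NonUnitalRingHom.id S) N h.mul_mem_N
  rightN := AddSubgroup.rightAct ι N fun r n _ => h.mul_mem_N n _ (h.map_mem_N r)
  commM _ _ _ := Subtype.ext (mul_assoc _ _ _)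
  commN _ _ _ := Subtype.ext (mul_assoc _ _ _)
  leftM_unitary := by
    refine AddSubgroup.closure_eq_top_of_le h.M_le ?_
    rintro _ ⟨r, m, hm, rfl⟩
    exact ⟨_, ⟨r, ⟨m, hm⟩, rfl⟩, rfl⟩
  rightM_unitary := by
    -- `M = R M` and `R ⊆ M`, so that `M ⊆ M S`
    refine AddSubgroup.closure_eq_top_of_le h.M_le ?_
    rintro _ ⟨r, m, hm, rfl⟩
    exact ⟨_, ⟨.op m, ⟨ι r, h.map_mem_M r⟩, rfl⟩, rfl⟩
  leftN_unitary := by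
    refine AddSubgroup.closure_eq_top_of_le h.N_le ?_
    rintro _ ⟨r, n, hn, rfl⟩
    exact ⟨_, ⟨n, ⟨ι r, h.map_mem_N r⟩, rfl⟩, rfl⟩
  rightN_unitary := by
    refine AddSubgroup.closure_eq_top_of_le h.N_le ?_
    rintro _ ⟨r, n, hn, rfl⟩
    exact ⟨_, ⟨.op r, ⟨n, hn⟩, rfl⟩, rfl⟩
  τ := AddMonoidHom.mk' (fun m => AddMonoidHom.mk' (fun n => h.preimage m n)
      (fun n n' => h.injective (by simp only [map_add, map_preimage]; exact mul_add _ _ _)))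
    (fun m m' => AddMonoidHom.ext fun n => h.injective (by
      simp only [AddMonoidHom.add_apply, AddMonoidHom.mk'_apply, map_add, map_preimage]
      exact add_mul _ _ _))
  τ' := AddMonoidHom.mk' (fun n => AddMonoidHom.mk' (fun m => (n : S) * m)
      (fun m m' => mul_add _ _ _))
    (fun n n' => AddMonoidHom.ext fun m => add_mul _ _ _)
  τ_balanced m s n := h.injective
    ((h.map_preimage _ _).trans ((mul_assoc _ _ _).trans
      (h.map_preimage m (AddSubgroup.leftAct (NonUnitalRingHom.id S) N h.mul_mem_N s n)).symm))
  τ_left r m n := h.injective ((h.map_preimage _ _).trans ((mul_assoc _ _ _).trans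
    ((congrArg (ι r * ·) (h.map_preimage m n)).symm.trans (map_mul ι _ _).symm)))
  τ_right m n r := h.injective ((h.map_preimage _ _).trans ((mul_assoc _ _ _).symm.trans
    ((congrArg (· * ι r) (h.map_preimage m n)).symm.trans (map_mul ι _ _).symm)))
  τ'_balanced _ _ _ := mul_assoc _ _ _
  τ'_left _ _ _ := mul_assoc _ _ _
  τ'_right _ _ _ := (mul_assoc _ _ _).symm
  assocM m n m' := Subtype.ext
    ((congrArg (· * (m' : S)) (h.map_preimage m n)).trans (mul_assoc _ _ _))
  assocN n m n' := Subtype.ext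
    ((mul_assoc _ _ _).trans (congrArg ((n : S) * ·) (h.map_preimage m n')).symm)

theorem context_isSurjective : h.context.IsSurjective := by
  constructor
  · refine top_le_iff.1 fun r _ => ?_
    refine AddSubgroup.mem_closure_of_injective (f := (ι : R →+ S)) h.injective ?_
    refine AddSubgroup.closure_mono ?_ (h.map_mem_closure r)
    rintro _ ⟨m, hm, n, hn, rfl⟩
    exact ⟨_, ⟨⟨m, hm⟩, ⟨n, hn⟩, rfl⟩, h.map_preimage _ _⟩
  · rw [← h.closure_eq_top]
    congr 1
    ext s
    constructor
    · rintro ⟨n, m, rfl⟩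
      exact ⟨_, Subtype.prop (p := (· ∈ N)) n, _, Subtype.prop (p := (· ∈ M)) m, rfl⟩
    · rintro ⟨n, hn, m, hm, rfl⟩
      exact ⟨⟨n, hn⟩, ⟨m, hm⟩, rfl⟩

end IsMoritaEmbedding

end OfEmbedding

/-! ### Crossed products by global twisted actions -/

namespace TwistedPartialAction

namespace IsGlobal

variable {G : Type w} [Group G] {B : Type v} [NonUnitalRing B] {β : TwistedPartialAction G B}
  (h : β.IsGlobal)

/-- The automorphism `β g` of `B`. -/
def aut (g : G) : B ≃+* B where
  toFun b := β.ap g b (h.mem _ _)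
  invFun b := β.apInv g b (h.mem _ _)
  left_inv b := β.apInv_ap g b _
  right_inv b := β.ap_apInv g b _
  map_mul' a b := β.ap_mul g a b _ _ _
  map_add' a b := β.ap_add g a b _ _ _

/-- Right multiplication by the multiplier `u g k`, as an additive automorphism of `B`. -/
def mulTwist (g k : G) : B ≃+ B where
  toFun b := Multiplier.ract (β.w g k) b (h.mem_prod _ _ _)
  invFun b := Multiplier.ract (β.w g k)⁻¹ b (h.mem_prod _ _ _)
  left_inv b := by
    have e := Multiplier.ract_inv_ract (β.w g k)⁻¹ b (h.mem_prod _ _ _)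
    rwa [inv_inv] at e
  right_inv b := Multiplier.ract_inv_ract (β.w g k) b (h.mem_prod _ _ _)
  map_add' a b := Multiplier.ract_add _ a b _ _ _

/-- Left multiplication by the multiplier `u g k`. -/
def twistMul (g k : G) (b : B) : B := Multiplier.lact (β.w g k) b (h.mem_prod _ _ _)

theorem mulTwist_mul (g k : G) (a b : B) : h.mulTwist g k (a * b) = a * h.mulTwist g k b :=
  Multiplier.ract_mul _ a b (h.mem_prod _ _ _) (h.mem_prod _ _ _) _

theorem mulTwist_mul_eq (g k : G) (a b : B) : h.mulTwist g k a * b = a * h.twistMul g k b :=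
  congrArg Subtype.val ((β.w g k).val.property.2.2
    ⟨a, h.mem_prod g (g * k) a⟩ ⟨b, h.mem_prod g (g * k) b⟩)

theorem mulTwist_aut_aut (g k : G) (b : B) :
    h.mulTwist g k (h.aut g (h.aut k b)) = h.twistMul g k (h.aut (g * k) b) :=
  (congrArg (h.mulTwist g k) (β.comp_eq g k b (h.mem_prod _ _ _))).trans
    ((h.mulTwist g k).apply_symm_apply _)

theorem mulTwist_one_left (g : G) (b : B) : h.mulTwist 1 g b = b := by
  change Multiplier.ract (β.w 1 g) b _ = b
  rw [β.w_one_left]; rfl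

theorem mulTwist_one_right (g : G) (b : B) : h.mulTwist g 1 b = b := by
  change Multiplier.ract (β.w g 1) b _ = b
  rw [β.w_one_right]; rfl

theorem aut_one (b : B) : h.aut 1 b = b := β.α_one ⟨b, h.mem _ _⟩

/-- The element `b δ g` of the crossed product by a global action, for `b` in `B`. -/
noncomputable def single (g : G) : B →+ β.CrossedProduct :=
  (CrossedProduct.single β g).comp
    (AddMonoidHom.mk' (fun b => (⟨b, h.mem g b⟩ : β.D g)) fun _ _ => rfl)

theorem single_mul_single (g k : G) (a b : B) :
    h.single g a * h.single k b = h.single (g * k) (h.mulTwist g k (a * h.aut g b)) := by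
  refine (CrossedProduct.single_mul_single β g k _ _).trans ?_
  refine CrossedProduct.single_congr β rfl _ _ ?_
  refine congrArg (h.mulTwist g k) (?_ : β.core g a b _ = a * h.aut g b)
  exact (map_mul (h.aut g) _ b).trans (congrArg (· * h.aut g b) ((h.aut g).apply_symm_apply a))

/-- `(b δ g) (β k a δ k) = (b u g k) β (g k) a δ (g k)` -/
theorem single_mul_single_aut (g k : G) (b a : B) :
    h.single g b * h.single k (h.aut k a) =
      h.single (g * k) (h.mulTwist g k b * h.aut (g * k) a) := by
  rw [single_mul_single, mulTwist_mul, mulTwist_aut_aut, mulTwist_mul_eq]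

theorem single_one_mul_single (g : G) (a b : B) :
    h.single 1 a * h.single g b = h.single g (a * b) := by
  rw [single_mul_single, mulTwist_one_left, aut_one, one_mul]

theorem single_mul_single_one (g : G) (a b : B) :
    h.single g a * h.single 1 b = h.single g (a * h.aut g b) := by
  rw [single_mul_single, mulTwist_one_right, mul_one]

theorem induction {p : β.CrossedProduct → Prop} (h0 : p 0) (h1 : ∀ g b, p (h.single g b))
    (h2 : ∀ x y, p x → p y → p (x + y)) (x : β.CrossedProduct) : p x :=
  CrossedProduct.induction β h0 (fun g b => h1 g b) h2 x

end IsGlobal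

end TwistedPartialAction

/-! ### The Morita context of a globalization -/

namespace IsGlobalizationVia

open TwistedPartialAction

variable {G : Type w} [Group G] {A : Type u} [NonUnitalRing A] {B : Type v} [NonUnitalRing B]
  {α : TwistedPartialAction G A} {β : TwistedPartialAction G B} {φ : A →ₙ+* B}
  (h : IsGlobalizationVia α β φ)

theorem map_coeff (g k : G) (a b : A) (ha : a ∈ α.D g) (hb : b ∈ α.D k) :
    φ (α.coeff g k a b ha hb) =
      h.isGlobal.mulTwist g k (φ a * h.isGlobal.aut g (φ b)) := by
  refine (h.map_ract g k _ (α.core_mem ha hb)).trans ?_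
  refine congrArg (h.isGlobal.mulTwist g k) ?_
  refine (h.map_α g _ _).trans ?_
  refine (congrArg (h.isGlobal.aut g) (map_mul φ _ _)).trans ?_
  refine (map_mul (h.isGlobal.aut g) _ _).trans ?_
  refine congrArg (· * h.isGlobal.aut g (φ b)) ?_
  refine (h.map_α g _ (α.apInv_mem g a ha)).symm.trans ?_
  rw [α.ap_apInv]

open Classical in
/-- The map `a δ g ↦ φ a δ g` of direct sums. -/
noncomputable def embeddingAddHom : α.CrossedProduct →+ β.CrossedProduct :=
  DirectSum.map fun g => AddMonoidHom.mk' (fun a : α.D g =>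
    (⟨φ a, h.isGlobal.mem g _⟩ : β.D g))
    fun a b => Subtype.ext (map_add φ a.1 b.1)

theorem embeddingAddHom_single (g : G) (a : α.D g) :
    h.embeddingAddHom (CrossedProduct.single α g a) = h.isGlobal.single g (φ a) := by
  classical
  exact DirectSum.map_of _ _ _

theorem embeddingAddHom_injective : Function.Injective h.embeddingAddHom := by
  classical
  refine (DirectSum.map_injective _).2 fun g a b hab => ?_
  exact Subtype.ext (h.injective (congrArg Subtype.val hab))

/-- The embedding `a δ g ↦ φ a δ g` of crossed products. -/
noncomputable def embedding : α.CrossedProduct →ₙ+* β.CrossedProduct where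
  toFun := h.embeddingAddHom
  map_zero' := map_zero _
  map_add' := map_add _
  map_mul' x y := by
    induction x using CrossedProduct.induction with
    | h0 => simp
    | h2 x x' hx hx' => simp [add_mul, hx, hx']
    | h1 g a =>
      induction y using CrossedProduct.induction with
      | h0 => simp
      | h2 y y' hy hy' => simp [mul_add, hy, hy']
      | h1 k b =>
        rw [CrossedProduct.single_mul_single]
        simp only [embeddingAddHom_single]
        rw [IsGlobal.single_mul_single, h.map_coeff]

theorem embedding_single (g : G) (a : α.D g) :
    h.embedding (CrossedProduct.single α g a) = h.isGlobal.single g (φ a) :=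
  h.embeddingAddHom_single g a

/-- The right ideal of the elements of `β.CrossedProduct` with coefficients in `φ A`. -/
noncomputable def rightIdeal : AddSubgroup β.CrossedProduct :=
  AddSubgroup.closure {z | ∃ (g : G) (a : A), z = h.isGlobal.single g (φ a)}

/-- The left ideal of the elements of `β.CrossedProduct` whose coefficient at each `g` is in
`β g (φ A)`. -/
noncomputable def leftIdeal : AddSubgroup β.CrossedProduct :=
  AddSubgroup.closure {z | ∃ (g : G) (a : A),
    z = h.isGlobal.single g (h.isGlobal.aut g (φ a))}

theorem single_mem_rightIdeal (g : G) (a : A) : h.isGlobal.single g (φ a) ∈ h.rightIdeal :=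
  AddSubgroup.subset_closure ⟨g, a, rfl⟩

theorem single_mem_leftIdeal (g : G) (a : A) :
    h.isGlobal.single g (h.isGlobal.aut g (φ a)) ∈ h.leftIdeal :=
  AddSubgroup.subset_closure ⟨g, a, rfl⟩

theorem rightIdeal_le {P : AddSubgroup β.CrossedProduct}
    (hP : ∀ g a, h.isGlobal.single g (φ a) ∈ P) : h.rightIdeal ≤ P := by
  refine (AddSubgroup.closure_le _).2 ?_
  rintro _ ⟨g, a, rfl⟩
  exact hP g a

theorem leftIdeal_le {P : AddSubgroup β.CrossedProduct}
    (hP : ∀ g a, h.isGlobal.single g (h.isGlobal.aut g (φ a)) ∈ P) : h.leftIdeal ≤ P := by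
  refine (AddSubgroup.closure_le _).2 ?_
  rintro _ ⟨g, a, rfl⟩
  exact hP g a

/-- As `φ A` is a left `s`-unital ideal, its multipliers preserve it: `(e a) u = e (a u)`. -/
theorem mulTwist_mem_range (hA : IsLeftSUnital A) (g k : G) (a : A) (b : B) :
    h.isGlobal.mulTwist g k (φ a * b) ∈ Set.range φ := by
  obtain ⟨e, he⟩ := hA a
  rw [← he, map_mul φ, mul_assoc, IsGlobal.mulTwist_mul]
  exact h.mul_mem_right _ _

theorem single_mem_range_embedding {g : G} {b : B} (h1 : b ∈ Set.range φ)
    (h2 : ∃ a, b = h.isGlobal.aut g (φ a)) : h.isGlobal.single g b ∈ h.embedding.range := by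
  obtain ⟨a, ha, rfl⟩ := (h.image_D g).ge ⟨h1, h2⟩
  exact ⟨_, h.embedding_single g ⟨a, ha⟩⟩

theorem exists_mul_aut_eq (g : G) (a : A) (b : B) :
    ∃ a', b * h.isGlobal.aut g (φ a) = h.isGlobal.aut g (φ a') := by
  obtain ⟨a', ha'⟩ := h.mul_mem_left ((h.isGlobal.aut g).symm b) a
  refine ⟨a', ?_⟩
  rw [ha', map_mul, RingEquiv.apply_symm_apply]

theorem single_one_mem_range_embedding (a : A) :
    ∃ r, h.embedding r = h.isGlobal.single 1 (φ a) :=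
  ⟨_, h.embedding_single 1 ⟨a, by rw [α.D_one]; trivial⟩⟩

theorem mul_mem_rightIdeal (hA : IsLeftSUnital A) {m : β.CrossedProduct}
    (hm : m ∈ h.rightIdeal) (s : β.CrossedProduct) : m * s ∈ h.rightIdeal := by
  refine h.rightIdeal_le (P := h.rightIdeal.comap (AddMonoidHom.mulRight s))
    (fun g a => ?_) hm
  refine AddSubgroup.mem_comap.2 ?_
  rw [AddMonoidHom.mulRight_apply]
  induction s using h.isGlobal.induction with
  | h0 => rw [mul_zero]; exact zero_mem _
  | h2 s t hs ht => rw [mul_add]; exact add_mem hs ht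
  | h1 k b =>
    obtain ⟨a', ha'⟩ := h.mulTwist_mem_range hA g k a (h.isGlobal.aut g b)
    rw [IsGlobal.single_mul_single, ← ha']
    exact h.single_mem_rightIdeal _ _

theorem mul_mem_leftIdeal (s : β.CrossedProduct) {n : β.CrossedProduct}
    (hn : n ∈ h.leftIdeal) : s * n ∈ h.leftIdeal := by
  refine h.leftIdeal_le (P := h.leftIdeal.comap (AddMonoidHom.mulLeft s)) (fun g a => ?_) hn
  refine AddSubgroup.mem_comap.2 ?_
  rw [AddMonoidHom.coe_mulLeft]
  induction s using h.isGlobal.induction with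
  | h0 => rw [zero_mul]; exact zero_mem _
  | h2 s t hs ht => rw [add_mul]; exact add_mem hs ht
  | h1 k b =>
    rw [IsGlobal.single_mul_single_aut]
    obtain ⟨a', ha'⟩ := h.exists_mul_aut_eq (k * g) a (h.isGlobal.mulTwist k g b)
    rw [ha']
    exact h.single_mem_leftIdeal _ _

theorem embedding_mem_rightIdeal (r : α.CrossedProduct) : h.embedding r ∈ h.rightIdeal := by
  induction r using CrossedProduct.induction with
  | h0 => rw [map_zero]; exact zero_mem _
  | h2 r r' hr hr' => rw [map_add]; exact add_mem hr hr'
  | h1 g a => rw [embedding_single]; exact h.single_mem_rightIdeal _ _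

theorem embedding_mem_leftIdeal (r : α.CrossedProduct) : h.embedding r ∈ h.leftIdeal := by
  induction r using CrossedProduct.induction with
  | h0 => rw [map_zero]; exact zero_mem _
  | h2 r r' hr hr' => rw [map_add]; exact add_mem hr hr'
  | h1 g a =>
    obtain ⟨a', ha'⟩ := ((h.image_D g).le ⟨a, a.2, rfl⟩).2
    rw [embedding_single, ha']
    exact h.single_mem_leftIdeal _ _

/-- The coefficients of a product `m n` at `g` are in `φ A ∩ β g (φ A) = φ (D g)`. -/
theorem mul_mem_range_embedding (hA : IsLeftSUnital A) {m n : β.CrossedProduct}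
    (hm : m ∈ h.rightIdeal) (hn : n ∈ h.leftIdeal) : m * n ∈ h.embedding.range := by
  let P : AddSubgroup β.CrossedProduct := (h.embedding : α.CrossedProduct →+ _).range
  refine h.rightIdeal_le (P := P.comap (AddMonoidHom.mulRight n)) (fun g a => ?_) hm
  refine h.leftIdeal_le (P := P.comap (AddMonoidHom.mulLeft _)) (fun k b => ?_) hn
  have hz : h.isGlobal.single g (φ a) * h.isGlobal.single k (h.isGlobal.aut k (φ b)) ∈
      h.embedding.range := by
    rw [IsGlobal.single_mul_single]
    refine h.single_mem_range_embedding (h.mulTwist_mem_range hA g k _ _) ?_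
    obtain ⟨a', ha'⟩ := h.exists_mul_aut_eq (g * k) b (h.isGlobal.mulTwist g k (φ a))
    refine ⟨a', ?_⟩
    rw [← ha', IsGlobal.mulTwist_mul, IsGlobal.mulTwist_aut_aut, IsGlobal.mulTwist_mul_eq]
  exact hz

/-- The products `n m` span `β.CrossedProduct`: as `A` is left `s`-unital and `u g k` is invertible,
`β g (φ A) = β g (φ A) β g (φ A) u g k`, and the sum of these ideals over all `g` is `B`. -/
theorem closure_leftIdeal_mul_rightIdeal (hA : IsLeftSUnital A) :
    AddSubgroup.closure {z | ∃ n ∈ h.leftIdeal, ∃ m ∈ h.rightIdeal, z = n * m} = ⊤ := by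
  refine top_le_iff.1 fun s _ => ?_
  set P := AddSubgroup.closure {z | ∃ n ∈ h.leftIdeal, ∃ m ∈ h.rightIdeal, z = n * m}
  induction s using h.isGlobal.induction with
  | h0 => exact zero_mem _
  | h2 s t hs ht => exact add_mem (hs trivial) (ht trivial)
  | h1 t b =>
    suffices hB : (⊤ : AddSubgroup B) ≤ P.comap (h.isGlobal.single t) from hB (x := b) trivial
    rw [← h.sum_eq_top, AddSubgroup.closure_le]
    rintro _ ⟨g, a, rfl⟩
    obtain ⟨k, rfl⟩ : ∃ k, t = g * k := ⟨g⁻¹ * t, (mul_inv_cancel_left g t).symm⟩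
    obtain ⟨e, he⟩ := hA a
    -- `β g (φ a) = (β g (φ e) c) u g k = β g (φ a') u g k` with `c = β g (φ a) (u g k)⁻¹`
    obtain ⟨c, hc⟩ := (h.isGlobal.mulTwist g k).surjective (h.isGlobal.aut g (φ a))
    obtain ⟨a', ha'⟩ := h.mul_mem_right ((h.isGlobal.aut g).symm c) e
    obtain ⟨e', he'⟩ := hA a'
    refine AddSubgroup.subset_closure ⟨_, h.single_mem_leftIdeal g e', _,
      h.single_mem_rightIdeal k a', ?_⟩
    rw [IsGlobal.single_mul_single, ← map_mul (h.isGlobal.aut g), ← map_mul φ, he', ha',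
      map_mul (h.isGlobal.aut g), RingEquiv.apply_symm_apply, IsGlobal.mulTwist_mul, hc,
      ← map_mul (h.isGlobal.aut g), ← map_mul φ, he]
    rfl

theorem isMoritaEmbedding (hA : IsLeftSUnital A) :
    IsMoritaEmbedding h.embedding h.rightIdeal h.leftIdeal where
  injective := h.embeddingAddHom_injective
  mul_mem_M _ hm s := h.mul_mem_rightIdeal hA hm s
  mul_mem_N s _ hn := h.mul_mem_leftIdeal s hn
  map_mem_M := h.embedding_mem_rightIdeal
  map_mem_N := h.embedding_mem_leftIdeal
  mul_mem_range _ hm _ hn := h.mul_mem_range_embedding hA hm hn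
  M_le := h.rightIdeal_le fun g a => by
    obtain ⟨e, he⟩ := hA a
    obtain ⟨r, hr⟩ := h.single_one_mem_range_embedding e
    refine AddSubgroup.subset_closure ⟨r, _, h.single_mem_rightIdeal g a, ?_⟩
    rw [hr, IsGlobal.single_one_mul_single, ← map_mul φ, he]
  N_le := h.leftIdeal_le fun g a => by
    obtain ⟨e, he⟩ := hA a
    obtain ⟨r, hr⟩ := h.single_one_mem_range_embedding a
    refine AddSubgroup.subset_closure ⟨r, _, h.single_mem_leftIdeal g e, ?_⟩
    rw [hr, IsGlobal.single_mul_single_one, ← map_mul (h.isGlobal.aut g), ← map_mul φ, he]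
  map_mem_closure r := by
    induction r using CrossedProduct.induction with
    | h0 => rw [map_zero]; exact zero_mem _
    | h2 r r' hr hr' => rw [map_add]; exact add_mem hr hr'
    | h1 g a =>
      obtain ⟨e, he⟩ := hA a
      refine AddSubgroup.subset_closure ⟨_, h.single_mem_rightIdeal 1 e, _,
        h.embedding_mem_leftIdeal (CrossedProduct.single α g a), ?_⟩
      rw [embedding_single, IsGlobal.single_one_mul_single, ← map_mul φ, he]
  closure_eq_top := h.closure_leftIdeal_mul_rightIdeal hA

end IsGlobalizationVia

theorem mainTheorem4 {G : Type w} [Group G] {A : Type u} [NonUnitalRing A]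
    {B : Type v} [NonUnitalRing B] (hA : IsLeftSUnital A)
    (α : TwistedPartialAction G A) (β : TwistedPartialAction G B) (hβ : IsGlobalization α β) :
    IsMoritaEquivalentIdempotent α.CrossedProduct β.CrossedProduct ∧
      ∃ C : MoritaContext.{max u w, max v w, max v w, max v w}
        α.CrossedProduct β.CrossedProduct, C.IsSurjective := by
  obtain ⟨φ, h⟩ := hβ
  have hC := (h.isMoritaEmbedding hA).context_isSurjective
  exact ⟨⟨hC.isIdempotentRing, hC.symm.isIdempotentRing,
    ⟨MoritaContext.IsSurjective.equivalence.{max u w, max v w, max v w, max u w} hC⟩⟩, _, hC⟩
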